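/- A quiver is a finite directed graph $Q$ (finite sets of vertices and arrows; loops, parallel arrows and several connected components are allowed). A minor of $Q$ is any quiver isomorphic to one obtained from $Q$ by contracting arrows and removing vertices and arrows. A tree quiver is a quiver whose underlying undirected (multi)graph is a tree. For a field $K$, the representation ring $R(Q)$ is the free abelian group on the isomorphism classes $[V]$ of finite-dimensional representations of $Q$ over $K$, modulo the subgroup generated by the elements $[V]+[W]-[V\oplus W]$, with multiplication $[V][W]=[V\otimes W]$ induced by the pointwise tensor product $(V\otimes W)_x=V_x\otimes_K W_x$. The quiver $Q$ is of finite multiplicative type over $K$ if $R(Q)_{red}$, the quotient of $R(Q)$ by its ideal of nilpotent elements, is a finitely generated $\mathbb{Z}$-module. Theorem. Let $K$ be a field. 1. If $Q$ is of finite multiplicative type over $K$, then so is every minor of $Q$. 2. The relation "is a minor of" is a preorder on quivers, and it well-quasi-orders the tree quivers: for every sequence $Q_0,Q_1,Q_2,\dots$ of tree quivers there are $m<n$ such that $Q_m$ is a minor of $Q_n$. 3. There is a finite set $\mathcal{F}$ of quivers such that a quiver $Q$ is of finite multiplicative type over $K$ if and only if no member of $\mathcal{F}$ is a minor of $Q$.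 -/

import Mathlib

universe w u

/-- A finite quiver `Q = (V, A, t, h)`: a finite directed graph (loops and parallel arrows are
allowed) with tail and head functions `t, h : A → V`. -/
structure FinQuiver : Type (w + 1) where
  /-- the vertices -/
  V : Type w
  /-- the arrows -/
  A : Type w
  finite_V : Finite V
  finite_A : Finite A
  /-- the tail of an arrow -/
  t : A → V
  /-- the head of an arrow -/
  h : A → V

namespace FinQuiver

/-- Contraction of a set `C` of arrows: the endpoints of every arrow in `C` are identified
(`Quot` takes the generated equivalence relation) and the arrows in `C` disappear. -/
def contract (Q : FinQuiver.{w}) (C : Set Q.A) : FinQuiver.{w} where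
  V := Quot fun x y : Q.V => ∃ a ∈ C, Q.t a = x ∧ Q.h a = y
  A := {a : Q.A // a ∉ C}
  finite_V := by
    have := Q.finite_V
    exact Finite.of_surjective (Quot.mk _) Quot.mk_surjective
  finite_A := by
    have := Q.finite_A
    infer_instance
  t := fun a => Quot.mk _ (Q.t a.1)
  h := fun a => Quot.mk _ (Q.h a.1)

/-- An embedding of quivers: it identifies `P` with a subquiver of `Q`, that is, with what is left
of `Q` after removing some vertices and arrows. -/
structure Embedding (P Q : FinQuiver.{w}) where
  onV : P.V → Q.V
  onA : P.A → Q.A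
  onV_injective : Function.Injective onV
  onA_injective : Function.Injective onA
  t_onA : ∀ a, Q.t (onA a) = onV (P.t a)
  h_onA : ∀ a, Q.h (onA a) = onV (P.h a)

/-- `P` is a minor of `Q`: up to isomorphism, `P` is obtained from `Q` by contracting arrows and
removing vertices and arrows. (Removals and contractions can always be reordered so that all the
contractions come first.) -/
def IsMinor (P Q : FinQuiver.{w}) : Prop :=
  ∃ C : Set Q.A, Nonempty (Embedding P (Q.contract C))

/-- The simple graph underlying a quiver (orientations, loops and multiplicities are forgotten). -/
def underlyingGraph (Q : FinQuiver.{w}) : SimpleGraph Q.V :=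
  SimpleGraph.fromRel fun x y => ∃ a : Q.A, Q.t a = x ∧ Q.h a = y

/-- A tree quiver: the underlying undirected multigraph has no loops and no multiple edges, and is
a tree. -/
def IsTree (Q : FinQuiver.{w}) : Prop :=
  (∀ a, Q.t a ≠ Q.h a) ∧ Function.Injective (fun a => s(Q.t a, Q.h a)) ∧ Q.underlyingGraph.IsTree

end FinQuiver

/-- A finite-dimensional representation of the quiver `Q` over the field `K`. -/
structure QuiverRep (K : Type u) [Field K] (Q : FinQuiver.{w}) : Type (max w (u + 1)) where
  /-- the vector space at a vertex -/
  obj : Q.V → Type u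
  [addCommGroup : ∀ x, AddCommGroup (obj x)]
  [module : ∀ x, Module K (obj x)]
  [finiteDimensional : ∀ x, FiniteDimensional K (obj x)]
  /-- the linear map over an arrow -/
  map : ∀ a : Q.A, obj (Q.t a) →ₗ[K] obj (Q.h a)

namespace QuiverRep

attribute [instance] addCommGroup module finiteDimensional

variable {K : Type u} [Field K] {Q : FinQuiver.{w}}

/-- An isomorphism of representations. -/
structure Iso (X Y : QuiverRep K Q) where
  /-- the linear isomorphism at a vertex -/
  equiv : ∀ x, X.obj x ≃ₗ[K] Y.obj x
  comm : ∀ a v, equiv (Q.h a) (X.map a v) = Y.map a (equiv (Q.t a) v)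

/-- Two representations are related if they are isomorphic. -/
instance isoSetoid (K : Type u) [Field K] (Q : FinQuiver.{w}) : Setoid (QuiverRep K Q) where
  r X Y := Nonempty (Iso X Y)
  iseqv :=
    { refl := fun X => ⟨⟨fun _ => LinearEquiv.refl K _, fun _ _ => rfl⟩⟩
      symm := fun {X Y} ⟨e⟩ => ⟨⟨fun x => (e.equiv x).symm, fun a v => by
        rw [LinearEquiv.symm_apply_eq, e.comm, LinearEquiv.apply_symm_apply]⟩⟩
      trans := fun {X Y Z} ⟨e⟩ ⟨f⟩ => ⟨⟨fun x => (e.equiv x).trans (f.equiv x), fun a v => by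
        simp only [LinearEquiv.trans_apply, e.comm, f.comm]⟩⟩ }

/-- The direct sum of two representations. -/
def dirSum (X Y : QuiverRep K Q) : QuiverRep K Q where
  obj x := X.obj x × Y.obj x
  map a := (X.map a).prodMap (Y.map a)

/-- The pointwise tensor product of two representations. -/
noncomputable def tensor (X Y : QuiverRep K Q) : QuiverRep K Q where
  obj x := TensorProduct K (X.obj x) (Y.obj x)
  map a := TensorProduct.map (X.map a) (Y.map a)

/-- The identity representation: `K` at each vertex and the identity map over each arrow. -/
def unit (K : Type u) [Field K] (Q : FinQuiver.{w}) : QuiverRep K Q where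
  obj _ := K
  map _ := LinearMap.id

/-- The set of isomorphism classes of representations. -/
def IsoClass (K : Type u) [Field K] (Q : FinQuiver.{w}) : Type (max w (u + 1)) :=
  Quotient (isoSetoid K Q)

namespace IsoClass

/-- Direct sum of isomorphism classes. -/
instance : Add (IsoClass K Q) where
  add := Quotient.map₂ dirSum fun _ _ ⟨e⟩ _ _ ⟨f⟩ =>
    ⟨⟨fun x => (e.equiv x).prodCongr (f.equiv x), fun a v =>
      Prod.ext (e.comm a v.1) (f.comm a v.2)⟩⟩

/-- Isomorphism classes form a commutative monoid under the tensor product. -/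
noncomputable instance : CommMonoid (IsoClass K Q) where
  mul := Quotient.map₂ tensor fun X X' ⟨e⟩ Y Y' ⟨f⟩ =>
    ⟨⟨fun x => TensorProduct.congr (e.equiv x) (f.equiv x), fun a v => by
      exact LinearMap.congr_fun (TensorProduct.ext'
        (g := (TensorProduct.congr (e.equiv _) (f.equiv _)).toLinearMap ∘ₗ
          TensorProduct.map (X.map a) (Y.map a))
        (h := TensorProduct.map (X'.map a) (Y'.map a) ∘ₗ
          (TensorProduct.congr (e.equiv _) (f.equiv _)).toLinearMap)
        fun p q => by simp [e.comm, f.comm]) v⟩⟩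
  one := Quotient.mk _ (unit K Q)
  mul_assoc := by
    rintro ⟨X⟩ ⟨Y⟩ ⟨Z⟩
    refine Quotient.sound ⟨⟨fun x => TensorProduct.assoc K _ _ _, fun a v => ?_⟩⟩
    exact LinearMap.congr_fun (TensorProduct.ext_threefold
      (g := (TensorProduct.assoc K _ _ _).toLinearMap ∘ₗ
        TensorProduct.map (TensorProduct.map (X.map a) (Y.map a)) (Z.map a))
      (h := TensorProduct.map (X.map a) (TensorProduct.map (Y.map a) (Z.map a)) ∘ₗ
        (TensorProduct.assoc K _ _ _).toLinearMap) fun _ _ _ => rfl) v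
  one_mul := by
    rintro ⟨X⟩
    refine Quotient.sound ⟨⟨fun x => TensorProduct.lid K _, fun a v => ?_⟩⟩
    exact LinearMap.congr_fun (TensorProduct.ext'
      (g := (TensorProduct.lid K _).toLinearMap ∘ₗ TensorProduct.map LinearMap.id (X.map a))
      (h := X.map a ∘ₗ (TensorProduct.lid K _).toLinearMap) fun p q => by simp) v
  mul_one := by
    rintro ⟨X⟩
    refine Quotient.sound ⟨⟨fun x => TensorProduct.rid K _, fun a v => ?_⟩⟩
    exact LinearMap.congr_fun (TensorProduct.ext'
      (g := (TensorProduct.rid K _).toLinearMap ∘ₗ TensorProduct.map (X.map a) LinearMap.id)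
      (h := X.map a ∘ₗ (TensorProduct.rid K _).toLinearMap) fun p q => by simp) v
  mul_comm := by
    rintro ⟨X⟩ ⟨Y⟩
    refine Quotient.sound ⟨⟨fun x => TensorProduct.comm K _ _, fun a v => ?_⟩⟩
    exact LinearMap.congr_fun (TensorProduct.ext'
      (g := (TensorProduct.comm K _ _).toLinearMap ∘ₗ TensorProduct.map (X.map a) (Y.map a))
      (h := TensorProduct.map (Y.map a) (X.map a) ∘ₗ (TensorProduct.comm K _ _).toLinearMap)
      fun p q => rfl) v

theorem mul_add' (X Y Z : IsoClass K Q) : X * (Y + Z) = X * Y + X * Z := by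
  obtain ⟨X⟩ := X
  obtain ⟨Y⟩ := Y
  obtain ⟨Z⟩ := Z
  refine Quotient.sound ⟨⟨fun x => TensorProduct.prodRight K K _ _ _, fun a v => ?_⟩⟩
  exact LinearMap.congr_fun (TensorProduct.ext'
    (g := (TensorProduct.prodRight K K _ _ _).toLinearMap ∘ₗ
      TensorProduct.map (X.map a) ((Y.map a).prodMap (Z.map a)))
    (h := ((TensorProduct.map (X.map a) (Y.map a)).prodMap
      (TensorProduct.map (X.map a) (Z.map a))) ∘ₗ (TensorProduct.prodRight K K _ _ _).toLinearMap)
    fun p q => by simp) v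

end IsoClass

/-- The elements `[X] + [Y] - [X ⊕ Y]` of the free abelian group on the isomorphism classes, which
is given the ring structure with `[X] * [Y] = [X ⊗ Y]`. -/
def relators (K : Type u) [Field K] (Q : FinQuiver.{w}) : Set (MonoidAlgebra ℤ (IsoClass K Q)) :=
  {r | ∃ X Y : IsoClass K Q, r = MonoidAlgebra.of ℤ _ X + MonoidAlgebra.of ℤ _ Y
    - MonoidAlgebra.of ℤ _ (X + Y)}

/-- The subgroup generated by the elements `[X] + [Y] - [X ⊕ Y]`; it is an ideal. -/
noncomputable def relIdeal (K : Type u) [Field K] (Q : FinQuiver.{w}) :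
    Ideal (MonoidAlgebra ℤ (IsoClass K Q)) where
  toAddSubmonoid := (AddSubgroup.closure (relators K Q)).toAddSubmonoid
  smul_mem' := by
    intro c r hr
    change c * r ∈ AddSubgroup.closure (relators K Q)
    change r ∈ AddSubgroup.closure (relators K Q) at hr
    induction hr using AddSubgroup.closure_induction with
    | mem r hr =>
      obtain ⟨X, Y, rfl⟩ := hr
      induction c using MonoidAlgebra.induction_on with
      | of Z =>
        refine AddSubgroup.subset_closure ⟨Z * X, Z * Y, ?_⟩
        rw [mul_sub, mul_add, ← map_mul, ← map_mul, ← map_mul, IsoClass.mul_add']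
      | add c d hc hd => rw [add_mul]; exact add_mem hc hd
      | smul n c hc => rw [smul_mul_assoc]; exact zsmul_mem hc n
    | zero => rw [mul_zero]; exact zero_mem _
    | add r s _ _ hr hs => rw [mul_add]; exact add_mem hr hs
    | neg r _ hr => rw [mul_neg]; exact neg_mem hr

end QuiverRep

/-- The representation ring `R(Q)`: the free abelian group on the isomorphism classes of
representations modulo the subgroup generated by the elements `[X] + [Y] - [X ⊕ Y]`, with
multiplication `[X] * [Y] = [X ⊗ Y]`. -/
abbrev RepRing (K : Type u) [Field K] (Q : FinQuiver.{w}) : Type (max w (u + 1)) :=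
  MonoidAlgebra ℤ (QuiverRep.IsoClass K Q) ⧸ QuiverRep.relIdeal K Q

/-- `Q` is of finite multiplicative type over `K`: the reduction of `R(Q)` is a finitely generated
`ℤ`-module. -/
def FiniteMultiplicativeType (K : Type u) [Field K] (Q : FinQuiver.{w}) : Prop :=
  Module.Finite ℤ (RepRing K Q ⧸ nilradical (RepRing K Q))

/-! Minor closedness comes from pulling representations back. Isomorphism classes cancel in direct
sums (Fitting's lemma), so non-isomorphic representations have different classes in `RepRing K Q`,
and every element of the ring is a difference of two classes (`cls_injective`, `exists_eq_cls_sub`).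
Restriction to a subquiver is therefore a surjective ring homomorphism, because representations
extend by zero. Pullback along a contraction is an injective one, because it reflects isomorphism.
Finiteness of the reduction over ℤ passes to quotient rings, and to subrings because ℤ is
Noetherian.

The well-quasi-order is Kruskal's theorem. Every tree quiver comes from an `OTree`, a binary
encoding of rooted trees with oriented edges (`exists_iso_toQuiver`). The encodings are
well-quasi-ordered by the minimal bad sequence argument (`partiallyWellOrderedOn_emb`), and an
embedding of encodings is realized by contractions of quivers (`OTree.Emb.isContraction`).

For the forbidden minors, traces of powers show that the loop is not of finite multiplicative type
(`not_finiteMultiplicativeType_loop`). A quiver without a loop minor is a disjoint union of trees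
(`isTree_component`), and its representation ring embeds in the product of those of its components,
so only the components matter. Among trees, the well-quasi-order leaves finitely many obstructions,
and the loop is added to these. -/

namespace FinQuiver

/-! ### The minor relation -/

/-- The relation joining the endpoints of the arrows in `C`. -/
def adjBy (Q : FinQuiver.{w}) (C : Set Q.A) (x y : Q.V) : Prop :=
  ∃ a ∈ C, Q.t a = x ∧ Q.h a = y

/-- A criterion that avoids computing in the quotient: `v` picks a representative in each class, and
`ρ`, constant on classes, certifies that the representatives stay distinct after the contraction. -/
theorem isMinor_of_retraction {P Q : FinQuiver.{w}} {W : Type*} (C : Set Q.A)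
    (v : P.V → Q.V) (e : P.A → Q.A) (ρ : Q.V → W) (hρ : ∀ a ∈ C, ρ (Q.t a) = ρ (Q.h a))
    (hv : Function.Injective (ρ ∘ v)) (he : Function.Injective e) (heC : ∀ a, e a ∉ C)
    (ht : ∀ a, Relation.EqvGen (Q.adjBy C) (Q.t (e a)) (v (P.t a)))
    (hh : ∀ a, Relation.EqvGen (Q.adjBy C) (Q.h (e a)) (v (P.h a))) : P.IsMinor Q := by
  refine ⟨C, ⟨⟨fun x => Quot.mk _ (v x), fun a => ⟨e a, heC a⟩, ?_, ?_, ?_, ?_⟩⟩⟩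
  · intro x y hxy
    refine hv ?_
    exact congrArg (Quot.lift ρ (by rintro _ _ ⟨a, ha, rfl, rfl⟩; exact hρ a ha)) hxy
  · intro a b hab
    exact he (congrArg Subtype.val hab)
  · intro a
    exact Quot.eqvGen_sound (ht a)
  · intro a
    exact Quot.eqvGen_sound (hh a)

theorem Embedding.isMinor {P Q : FinQuiver.{w}} (e : Embedding P Q) : P.IsMinor Q :=
  isMinor_of_retraction ∅ e.onV e.onA id (fun _ h => h.elim) e.onV_injective e.onA_injective
    (fun _ h => h) (fun a => by rw [e.t_onA]; exact .refl _) (fun a => by rw [e.h_onA]; exact .refl _)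

theorem IsMinor.refl (Q : FinQuiver.{w}) : Q.IsMinor Q :=
  Embedding.isMinor ⟨id, id, Function.injective_id, Function.injective_id, fun _ => rfl, fun _ => rfl⟩

theorem IsMinor.trans {P Q R : FinQuiver.{w}} (h₁ : P.IsMinor Q) (h₂ : Q.IsMinor R) :
    P.IsMinor R := by
  classical
  obtain ⟨C, ⟨f⟩⟩ := h₁
  obtain ⟨D, ⟨g⟩⟩ := h₂
  -- Both contractions are done at once in `R`: the arrows of `D`, and the copies in `R` of the
  -- arrows of `C`.
  let E : Set R.A := D ∪ {a | ∃ c ∈ C, (g.onA c).1 = a}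
  have hsec : ∀ x : Q.V, Quot.mk _ (g.onV x).out = g.onV x := fun x => Quot.out_eq _
  have hD : ∀ x y, Relation.EqvGen (R.adjBy D) x y → Relation.EqvGen (R.adjBy E) x y :=
    fun x y h => h.mono (by rintro _ _ ⟨a, ha, h⟩; exact ⟨a, Or.inl ha, h⟩)
  have hsec' : ∀ x : P.V, Quot.mk _ (f.onV x).out = f.onV x := fun x => Quot.out_eq _
  have key : ∀ x (r : R.V), Quot.mk _ r = g.onV x →
      Relation.EqvGen (R.adjBy E) r (g.onV x).out := by
    intro x r h
    exact hD _ _ (Quot.eqvGen_exact (h.trans (hsec x).symm))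
  have hQ : ∀ x y : Q.V, Relation.EqvGen (Q.adjBy C) x y →
      Relation.EqvGen (R.adjBy E) (g.onV x).out (g.onV y).out := by
    intro x y h
    induction h with
    | rel x y h =>
      obtain ⟨c, hc, rfl, rfl⟩ := h
      refine .trans _ (R.t (g.onA c).1) _ (.symm _ _ (key _ _ (g.t_onA c))) ?_
      refine .trans _ (R.h (g.onA c).1) _ (.rel _ _ ⟨_, Or.inr ⟨c, hc, rfl⟩, rfl, rfl⟩) ?_
      exact key _ _ (g.h_onA c)
    | refl x => exact .refl _
    | symm x y _ h => exact .symm _ _ h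
    | trans x y z _ _ h h' => exact .trans _ _ _ h h'
  -- Vertices in the image of `g` go to their class modulo `C`. The others are removed in passing to
  -- `Q` and touch no arrow of `C`, so they may keep their own values.
  let ρ : (R.contract D).V → (Q.contract C).V ⊕ (R.contract D).V := fun z =>
    if h : ∃ x, g.onV x = z then Sum.inl (Quot.mk _ h.choose) else Sum.inr z
  have hρ : ∀ x, ρ (g.onV x) = Sum.inl (Quot.mk _ x) := by
    intro x
    have h : ∃ x', g.onV x' = g.onV x := ⟨x, rfl⟩
    simp only [ρ, dif_pos h]
    exact congrArg (fun y => Sum.inl (Quot.mk _ y)) (g.onV_injective h.choose_spec)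
  refine isMinor_of_retraction E (fun x => (g.onV (f.onV x).out).out)
    (fun a => (g.onA (f.onA a).1).1) (fun r => ρ (Quot.mk _ r)) ?_ ?_ ?_ ?_ ?_ ?_
  · rintro a (ha | ⟨c, hc, rfl⟩)
    · exact congrArg ρ (Quot.sound ⟨a, ha, rfl, rfl⟩)
    · have h1 := g.t_onA c
      have h2 := g.h_onA c
      change ρ ((R.contract D).t (g.onA c)) = ρ ((R.contract D).h (g.onA c))
      rw [h1, h2, hρ, hρ]
      exact congrArg Sum.inl (Quot.sound ⟨c, hc, rfl, rfl⟩)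
  · intro x y hxy
    simp only [Function.comp, hsec, hρ] at hxy
    exact f.onV_injective ((hsec' x).symm.trans ((Sum.inl_injective hxy).trans (hsec' y)))
  · intro a b hab
    exact f.onA_injective (Subtype.ext (g.onA_injective (Subtype.ext hab)))
  · rintro a (ha | ⟨c, hc, h⟩)
    · exact (g.onA (f.onA a).1).2 ha
    · have := g.onA_injective (Subtype.ext h)
      exact (f.onA a).2 (this ▸ hc)
  · intro a
    refine .trans _ _ _ (key _ _ (g.t_onA _)) (hQ _ _ (Quot.eqvGen_exact ?_))
    exact (f.t_onA a).trans (hsec' _).symm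
  · intro a
    refine .trans _ _ _ (key _ _ (g.h_onA _)) (hQ _ _ (Quot.eqvGen_exact ?_))
    exact (f.h_onA a).trans (hsec' _).symm

theorem isPreorder_isMinor : IsPreorder FinQuiver.{w} FinQuiver.IsMinor where
  refl := IsMinor.refl
  trans _ _ _ := IsMinor.trans

/-! ### Rooted contractions and joins of quivers -/

/-- `P` is obtained from `Q` by contractions alone, and the point `q` goes to `p`. -/
def IsContraction (P : FinQuiver.{w}) (p : P.V) (Q : FinQuiver.{w}) (q : Q.V) : Prop :=
  ∃ (π : Q.V → P.V) (e : P.A → Q.A), π q = p ∧ Function.Surjective π ∧ Function.Injective e ∧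
    (∀ a, π (Q.t (e a)) = P.t a) ∧ (∀ a, π (Q.h (e a)) = P.h a) ∧
    (∀ b ∉ Set.range e, π (Q.t b) = π (Q.h b)) ∧
    ∀ x y, π x = π y → Relation.EqvGen (Q.adjBy (Set.range e)ᶜ) x y

theorem IsContraction.isMinor {P Q : FinQuiver.{w}} {p : P.V} {q : Q.V}
    (h : IsContraction P p Q q) : P.IsMinor Q := by
  obtain ⟨π, e, -, hs, he, ht, hh, hC, hf⟩ := h
  have hv := Function.surjInv_eq hs
  exact isMinor_of_retraction (Set.range e)ᶜ (Function.surjInv hs) e π (fun b hb => hC b hb)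
    (by intro x y hxy; simpa [hv] using hxy) he (fun a h => h ⟨a, rfl⟩)
    (fun a => hf _ _ (by rw [hv, ht])) (fun a => hf _ _ (by rw [hv, hh]))

/-- A quiver is connected if any two vertices are joined by an undirected walk. -/
def IsConn (Q : FinQuiver.{w}) : Prop := ∀ x y, Relation.EqvGen (Q.adjBy Set.univ) x y

/-- The quiver with one vertex and no arrows. -/
def point : FinQuiver.{w} where
  V := PUnit
  A := PEmpty
  finite_V := inferInstance
  finite_A := inferInstance
  t := PEmpty.elim
  h := PEmpty.elim

/-- The disjoint union of `P` and `Q` with a new arrow between `p` and `q`, oriented according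
to `b`. -/
def join (b : Bool) (P : FinQuiver.{w}) (p : P.V) (Q : FinQuiver.{w}) (q : Q.V) :
    FinQuiver.{w} where
  V := P.V ⊕ Q.V
  A := Option (P.A ⊕ Q.A)
  finite_V := by
    have := P.finite_V
    have := Q.finite_V
    infer_instance
  finite_A := by
    have := P.finite_A
    have := Q.finite_A
    infer_instance
  t a := a.elim (cond b (.inl p) (.inr q)) (Sum.map P.t Q.t)
  h a := a.elim (cond b (.inr q) (.inl p)) (Sum.map P.h Q.h)

section join

variable {b : Bool} {P Q : FinQuiver.{w}} {p : P.V} {q : Q.V}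

@[simp] theorem join_t_inl (a : P.A) : (join b P p Q q).t (some (.inl a)) = .inl (P.t a) := rfl
@[simp] theorem join_t_inr (a : Q.A) : (join b P p Q q).t (some (.inr a)) = .inr (Q.t a) := rfl
@[simp] theorem join_h_inl (a : P.A) : (join b P p Q q).h (some (.inl a)) = .inl (P.h a) := rfl
@[simp] theorem join_h_inr (a : Q.A) : (join b P p Q q).h (some (.inr a)) = .inr (Q.h a) := rfl

theorem join_eqvGen_inl {C : Set P.A} {D : Set (join b P p Q q).A}
    (h : ∀ a ∈ C, some (.inl a) ∈ D) {x y : P.V} (hxy : Relation.EqvGen (P.adjBy C) x y) :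
    Relation.EqvGen ((join b P p Q q).adjBy D) (.inl x) (.inl y) := by
  induction hxy with
  | rel x y h' =>
    obtain ⟨a, ha, rfl, rfl⟩ := h'
    exact .rel _ _ ⟨_, h a ha, rfl, rfl⟩
  | refl x => exact .refl _
  | symm x y _ h => exact .symm _ _ h
  | trans x y z _ _ h h' => exact .trans _ _ _ h h'

theorem join_eqvGen_inr {C : Set Q.A} {D : Set (join b P p Q q).A}
    (h : ∀ a ∈ C, some (.inr a) ∈ D) {x y : Q.V} (hxy : Relation.EqvGen (Q.adjBy C) x y) :
    Relation.EqvGen ((join b P p Q q).adjBy D) (.inr x) (.inr y) := by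
  induction hxy with
  | rel x y h' =>
    obtain ⟨a, ha, rfl, rfl⟩ := h'
    exact .rel _ _ ⟨_, h a ha, rfl, rfl⟩
  | refl x => exact .refl _
  | symm x y _ h => exact .symm _ _ h
  | trans x y z _ _ h h' => exact .trans _ _ _ h h'

theorem join_eqvGen_new {D : Set (join b P p Q q).A} (h : none ∈ D) :
    Relation.EqvGen ((join b P p Q q).adjBy D) (.inl p) (.inr q) := by
  cases b
  · exact .symm _ _ (.rel _ _ ⟨none, h, rfl, rfl⟩)
  · exact .rel _ _ ⟨none, h, rfl, rfl⟩

theorem IsConn.join (hP : P.IsConn) (hQ : Q.IsConn) : (join b P p Q q).IsConn := by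
  have key : ∀ x, Relation.EqvGen ((FinQuiver.join b P p Q q).adjBy Set.univ) x (.inr q) := by
    rintro (x | x)
    · exact .trans _ _ _ (join_eqvGen_inl (fun _ _ => Set.mem_univ _) (hP x p)) (join_eqvGen_new trivial)
    · exact join_eqvGen_inr (fun _ _ => Set.mem_univ _) (hQ x q)
  exact fun x y => .trans _ _ _ (key x) (.symm _ _ (key y))

/-- The new arrows match because both contractions respect the roots; this is why `IsContraction`
keeps track of a point. -/
theorem IsContraction.join {P' Q' : FinQuiver.{w}} {p' : P'.V} {q' : Q'.V}
    (h₁ : IsContraction P p P' p') (h₂ : IsContraction Q q Q' q') :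
    IsContraction (join b P p Q q) (.inr q) (join b P' p' Q' q') (.inr q') := by
  obtain ⟨π₁, e₁, hp, hs₁, he₁, ht₁, hh₁, hC₁, hf₁⟩ := h₁
  obtain ⟨π₂, e₂, hq, hs₂, he₂, ht₂, hh₂, hC₂, hf₂⟩ := h₂
  refine ⟨Sum.map π₁ π₂, Option.map (Sum.map e₁ e₂), congrArg Sum.inr hq, hs₁.sumMap hs₂,
    Option.map_injective (he₁.sumMap he₂), ?_, ?_, ?_, ?_⟩
  · rintro (_ | a | a)
    · cases b
      · exact congrArg Sum.inr hq
      · exact congrArg Sum.inl hp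
    · exact congrArg Sum.inl (ht₁ a)
    · exact congrArg Sum.inr (ht₂ a)
  · rintro (_ | a | a)
    · cases b
      · exact congrArg Sum.inl hp
      · exact congrArg Sum.inr hq
    · exact congrArg Sum.inl (hh₁ a)
    · exact congrArg Sum.inr (hh₂ a)
  · rintro (_ | a | a) ha
    · exact absurd ⟨none, rfl⟩ ha
    · refine congrArg Sum.inl (hC₁ a ?_)
      rintro ⟨c, rfl⟩
      exact ha ⟨some (.inl c), rfl⟩
    · refine congrArg Sum.inr (hC₂ a ?_)
      rintro ⟨c, rfl⟩
      exact ha ⟨some (.inr c), rfl⟩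
  · rintro (x | x) (y | y) hxy
    · refine join_eqvGen_inl ?_ (hf₁ x y (Sum.inl_injective hxy))
      rintro a ha ⟨_ | c | c, hc⟩
      · cases hc
      · exact ha ⟨c, Sum.inl_injective (Option.some_injective _ hc)⟩
      · cases hc
    · cases hxy
    · cases hxy
    · refine join_eqvGen_inr ?_ (hf₂ x y (Sum.inr_injective hxy))
      rintro a ha ⟨_ | c | c, hc⟩
      · cases hc
      · cases hc
      · exact ha ⟨c, Sum.inr_injective (Option.some_injective _ hc)⟩

/-- All of `Q` is contracted, together with the new arrow, into the fibre over `s`. Connectedness of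
`Q` keeps that fibre connected, and the new root `q` lies in it. -/
theorem IsContraction.join_left {S : FinQuiver.{w}} {s : S.V} (h : IsContraction S s P p)
    (hQ : Q.IsConn) : IsContraction S s (FinQuiver.join b P p Q q) (.inr q) := by
  obtain ⟨π, e, hp, hs, he, ht, hh, hC, hf⟩ := h
  have key : ∀ x y, π x = π y → Relation.EqvGen
      ((FinQuiver.join b P p Q q).adjBy (Set.range fun a => some (.inl (e a)))ᶜ)
      (.inl x) (.inl y) := by
    intro x y hxy
    refine join_eqvGen_inl ?_ (hf x y hxy)
    rintro a ha ⟨c, hc⟩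
    exact ha ⟨c, Sum.inl_injective (Option.some_injective _ hc)⟩
  have key' : ∀ x, Relation.EqvGen
      ((FinQuiver.join b P p Q q).adjBy (Set.range fun a => some (.inl (e a)))ᶜ)
      (.inl p) (.inr x) := by
    intro x
    refine .trans _ _ _ (join_eqvGen_new (by rintro ⟨c, hc⟩; cases hc)) (join_eqvGen_inr ?_ (hQ q x))
    rintro a - ⟨c, hc⟩
    cases hc
  refine ⟨Sum.elim π fun _ => s, fun a => some (.inl (e a)), rfl,
    fun x => (hs x).imp' Sum.inl fun _ h => h, fun a b h => he (Sum.inl_injective (Option.some_injective _ h)), ht, hh, ?_, ?_⟩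
  · rintro (_ | a | a) ha
    · cases b
      · exact hp.symm
      · exact hp
    · refine hC a ?_
      rintro ⟨c, rfl⟩
      exact ha ⟨c, rfl⟩
    · rfl
  · rintro (x | x) (y | y) hxy
    · exact key x y hxy
    · exact .trans _ _ _ (key x p (hxy.trans hp.symm)) (key' y)
    · exact .symm _ _ (.trans _ _ _ (key y p (hxy.symm.trans hp.symm)) (key' x))
    · exact .trans _ _ _ (.symm _ _ (key' x)) (key' y)

theorem IsContraction.join_right {S : FinQuiver.{w}} {s : S.V} (h : IsContraction S s Q q)
    (hP : P.IsConn) : IsContraction S s (FinQuiver.join b P p Q q) (.inr q) := by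
  obtain ⟨π, e, hq, hs, he, ht, hh, hC, hf⟩ := h
  have key : ∀ x y, π x = π y → Relation.EqvGen
      ((FinQuiver.join b P p Q q).adjBy (Set.range fun a => some (.inr (e a)))ᶜ)
      (.inr x) (.inr y) := by
    intro x y hxy
    refine join_eqvGen_inr ?_ (hf x y hxy)
    rintro a ha ⟨c, hc⟩
    exact ha ⟨c, Sum.inr_injective (Option.some_injective _ hc)⟩
  have key' : ∀ x, Relation.EqvGen
      ((FinQuiver.join b P p Q q).adjBy (Set.range fun a => some (.inr (e a)))ᶜ)
      (.inr q) (.inl x) := by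
    intro x
    refine .symm _ _ (.trans _ _ _ (join_eqvGen_inl ?_ (hP x p)) (join_eqvGen_new ?_))
    · rintro a - ⟨c, hc⟩
      cases hc
    · rintro ⟨c, hc⟩
      cases hc
  refine ⟨Sum.elim (fun _ => s) π, fun a => some (.inr (e a)), hq,
    fun x => (hs x).imp' Sum.inr fun _ h => h, fun a b h => he (Sum.inr_injective (Option.some_injective _ h)), ht, hh, ?_, ?_⟩
  · rintro (_ | a | a) ha
    · cases b
      · exact hq
      · exact hq.symm
    · rfl
    · refine hC a ?_
      rintro ⟨c, rfl⟩
      exact ha ⟨c, rfl⟩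
  · rintro (x | x) (y | y) hxy
    · exact .trans _ _ _ (.symm _ _ (key' x)) (key' y)
    · exact .symm _ _ (.trans _ _ _ (key y q (hxy.symm.trans hq.symm)) (key' x))
    · exact .trans _ _ _ (key x q (hxy.trans hq.symm)) (key' y)
    · exact key x y hxy

end join

end FinQuiver

/-! ### Kruskal's theorem for oriented trees -/

/-- Rooted trees with oriented edges: `cons b c r` is obtained from `r` and `c` by joining their
roots by an edge with orientation `b`; the root is that of `r`. -/
inductive OTree
  | nil
  | cons (b : Bool) (c r : OTree)

namespace OTree

/-- The number of edges. -/
def size : OTree → ℕ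
  | nil => 0
  | cons _ c r => c.size + r.size + 1

/-- Homeomorphic embedding of rooted trees. -/
inductive Emb : OTree → OTree → Prop
  | nil (t : OTree) : Emb nil t
  | cons (b : Bool) {c r c' r' : OTree} : Emb c c' → Emb r r' → Emb (cons b c r) (cons b c' r')
  | left (b : Bool) {s c : OTree} (r : OTree) : Emb s c → Emb s (cons b c r)
  | right (b : Bool) {s r : OTree} (c : OTree) : Emb s r → Emb s (cons b c r)

theorem Emb.refl : ∀ t, Emb t t
  | .nil => .nil _
  | .cons b c r => .cons b (Emb.refl c) (Emb.refl r)

theorem Emb.trans {s t u : OTree} (h₁ : Emb s t) (h₂ : Emb t u) : Emb s u := by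
  induction h₂ generalizing s with
  | nil t => cases h₁; exact .nil _
  | cons b _ _ ih₁ ih₂ =>
    cases h₁ with
    | nil => exact .nil _
    | cons _ h h' => exact .cons b (ih₁ h) (ih₂ h')
    | left _ _ h => exact .left b _ (ih₁ h)
    | right _ _ h => exact .right b _ (ih₂ h)
  | left b r _ ih => exact .left b r (ih h₁)
  | right b c _ ih => exact .right b c (ih h₁)

instance : IsPreorder OTree Emb where
  refl := Emb.refl
  trans _ _ _ := Emb.trans

open Set.PartiallyWellOrderedOn in
-- Nash-Williams: in a minimal bad sequence no term is `nil`, and the immediate subtrees form a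
-- well-quasi-ordered set, since a bad sequence of subtrees could be spliced into the minimal one.
-- By the product lemma two terms then have equal orientation and embeddable parts, so the sequence
-- was not bad.
theorem partiallyWellOrderedOn_emb : (Set.univ : Set OTree).PartiallyWellOrderedOn Emb := by
  rw [iff_not_exists_isMinBadSeq size]
  rintro ⟨f, ⟨-, hf⟩, hmin⟩
  have hcons : ∀ n, ∃ b c r, f n = cons b c r := by
    intro n
    rcases h : f n with _ | ⟨b, c, r⟩
    · exact absurd (h ▸ Emb.nil _) (hf n (n + 1) n.lt_succ_self)
    · exact ⟨b, c, r, rfl⟩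
  choose b c r hcr using hcons
  let S : Set OTree := Set.range c ∪ Set.range r
  have hS : S.PartiallyWellOrderedOn Emb := by
    rw [iff_forall_not_isBadSeq]
    rintro g ⟨hg, hbad⟩
    have hidx : ∀ n, ∃ k, (g n).size < (f k).size ∧ ∀ s, Emb s (g n) → Emb s (f k) := by
      intro n
      rcases hg n with ⟨k, hk⟩ | ⟨k, hk⟩
      · exact ⟨k, by rw [hcr, ← hk, size]; omega, fun s hs => by rw [hcr]; exact .left _ _ (hk ▸ hs)⟩
      · exact ⟨k, by rw [hcr, ← hk, size]; omega, fun s hs => by rw [hcr]; exact .right _ _ (hk ▸ hs)⟩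
    choose k hk hkE using hidx
    -- Minimality of `k n₀` ensures that every later `g n` lies below some `f (k n)` with index at
    -- least `k n₀`, so an embedding of an earlier `f i` into `g n` would contradict the badness of
    -- `f`.
    obtain ⟨n₀, hn₀⟩ : ∃ n₀, ∀ n, k n₀ ≤ k n := by
      obtain ⟨n₀, h⟩ := WellFounded.has_min (measure k).wf Set.univ ⟨0, trivial⟩
      exact ⟨n₀, fun n => not_lt.mp (h.2 n trivial)⟩
    refine hmin (k n₀) (fun m => if m < k n₀ then f m else g (n₀ + (m - k n₀))) ?_ ?_ ?_
    · intro m hm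
      simp [hm]
    · simpa using hk n₀
    · refine ⟨fun _ => trivial, fun i j hij => ?_⟩
      by_cases hj : j < k n₀
      · simpa [hj, hij.trans hj] using hf i j hij
      · by_cases hi : i < k n₀
        · simp only [hj, hi, if_true, if_false]
          intro h
          exact hf i _ (hi.trans_le (hn₀ _)) (hkE _ _ h)
        · simp only [hj, hi, if_false]
          exact hbad _ _ (by omega)
  have hprod := (hS.prod hS)
  have hb : (Set.univ : Set Bool).PartiallyWellOrderedOn (· = ·) :=
    Set.Finite.partiallyWellOrderedOn Set.finite_univ
  have := hb.prod hprod
  rw [iff_forall_not_isBadSeq] at this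
  refine this (fun n => (b n, c n, r n)) ⟨fun n => ⟨trivial, Or.inl ⟨n, rfl⟩, Or.inr ⟨n, rfl⟩⟩, ?_⟩
  rintro m n hmn ⟨h₁, h₂, h₃⟩
  apply hf m n hmn
  rw [hcr, hcr]
  simp only at h₁
  rw [h₁]
  exact .cons _ h₂ h₃

/-- The quiver of an oriented rooted tree, with its root. -/
def toQuiver : OTree → (Q : FinQuiver.{w}) × Q.V
  | nil => ⟨.point, PUnit.unit⟩
  | cons b c r => ⟨.join b c.toQuiver.1 c.toQuiver.2 r.toQuiver.1 r.toQuiver.2, .inr r.toQuiver.2⟩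

theorem isConn_toQuiver : ∀ t : OTree, t.toQuiver.1.IsConn
  | nil => fun _ _ => .refl _
  | cons _ c r => (isConn_toQuiver c).join (isConn_toQuiver r)

/-- Each constructor of `Emb` is an operation on rooted contractions: collapsing a connected quiver
to a point, joining two contractions, or absorbing one side of a join into the root. -/
theorem Emb.isContraction {s t : OTree} (h : Emb s t) :
    FinQuiver.IsContraction.{w} s.toQuiver.1 s.toQuiver.2 t.toQuiver.1 t.toQuiver.2 := by
  induction h with
  | nil t =>
    refine ⟨fun _ => PUnit.unit, PEmpty.elim, rfl, fun x => ⟨t.toQuiver.2, rfl⟩, fun a => a.elim,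
      fun a => a.elim, fun a => a.elim, fun _ _ => rfl, fun x y _ => ?_⟩
    exact (t.isConn_toQuiver x y).mono (by
      rintro _ _ ⟨a, -, h⟩
      exact ⟨a, fun ⟨b, _⟩ => b.elim, h⟩)
  | cons b _ _ h₁ h₂ => exact h₁.join h₂
  | left b r _ h => exact h.join_left r.isConn_toQuiver
  | right b c _ h => exact h.join_right c.isConn_toQuiver

end OTree

/-! ### Isomorphisms of quivers and rearrangement of joins -/

namespace FinQuiver

/-- An isomorphism of quivers. -/
structure Iso (P Q : FinQuiver.{w}) where
  onV : P.V ≃ Q.V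
  onA : P.A ≃ Q.A
  t_onA : ∀ a, Q.t (onA a) = onV (P.t a)
  h_onA : ∀ a, Q.h (onA a) = onV (P.h a)

namespace Iso

variable {P Q R : FinQuiver.{w}}

/-- The inverse isomorphism. -/
def symm (e : Iso P Q) : Iso Q P where
  onV := e.onV.symm
  onA := e.onA.symm
  t_onA a := by rw [Equiv.eq_symm_apply, ← e.t_onA, Equiv.apply_symm_apply]
  h_onA a := by rw [Equiv.eq_symm_apply, ← e.h_onA, Equiv.apply_symm_apply]

/-- The composite of two isomorphisms. -/
def trans (e : Iso P Q) (f : Iso Q R) : Iso P R where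
  onV := e.onV.trans f.onV
  onA := e.onA.trans f.onA
  t_onA a := by simp [f.t_onA, e.t_onA]
  h_onA a := by simp [f.h_onA, e.h_onA]

theorem isMinor (e : Iso P Q) : P.IsMinor Q :=
  Embedding.isMinor ⟨e.onV, e.onA, e.onV.injective, e.onA.injective, e.t_onA, e.h_onA⟩

/-- Joins of isomorphic quivers are isomorphic. -/
def join {P' Q' : FinQuiver.{w}} (b : Bool) (e : Iso P P') (f : Iso Q Q') {p : P.V} {q : Q.V}
    {p' : P'.V} {q' : Q'.V} (hp : e.onV p = p') (hq : f.onV q = q') :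
    Iso (FinQuiver.join b P p Q q) (FinQuiver.join b P' p' Q' q') where
  onV := Equiv.sumCongr e.onV f.onV
  onA := Equiv.optionCongr (Equiv.sumCongr e.onA f.onA)
  t_onA := by
    subst hp hq
    rintro (_ | a | a)
    · cases b <;> rfl
    · exact congrArg Sum.inl (e.t_onA a)
    · exact congrArg Sum.inr (f.t_onA a)
  h_onA := by
    subst hp hq
    rintro (_ | a | a)
    · cases b <;> rfl
    · exact congrArg Sum.inl (e.h_onA a)
    · exact congrArg Sum.inr (f.h_onA a)

/-- The identity isomorphism. -/
def refl (P : FinQuiver.{w}) : Iso P P := ⟨Equiv.refl _, Equiv.refl _, fun _ => rfl, fun _ => rfl⟩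

/-- Joining a quiver to the left part of a join. -/
def joinLeft (b b' : Bool) (P Q R : FinQuiver.{w}) (p : P.V) (q q' : Q.V) (r : R.V) :
    Iso (FinQuiver.join b P p (FinQuiver.join b' Q q R r) (.inl q'))
      (FinQuiver.join b' (FinQuiver.join b P p Q q') (.inr q) R r) where
  onV := (Equiv.sumAssoc _ _ _).symm
  onA :=
    { toFun := fun
        | none => some (.inl none)
        | some (.inl a) => some (.inl (some (.inl a)))
        | some (.inr none) => none
        | some (.inr (some (.inl a))) => some (.inl (some (.inr a)))
        | some (.inr (some (.inr a))) => some (.inr a)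
      invFun := fun
        | none => some (.inr none)
        | some (.inl none) => none
        | some (.inl (some (.inl a))) => some (.inl a)
        | some (.inl (some (.inr a))) => some (.inr (some (.inl a)))
        | some (.inr a) => some (.inr (some (.inr a)))
      left_inv := by rintro (_ | a | _ | a | a) <;> rfl
      right_inv := by rintro (_ | (_ | a | a) | a) <;> rfl }
  t_onA := by rintro (_ | a | _ | a | a) <;> cases b <;> cases b' <;> rfl
  h_onA := by rintro (_ | a | _ | a | a) <;> cases b <;> cases b' <;> rfl

/-- Joining a quiver to the right part of a join. -/
def joinRight (b b' : Bool) (P Q R : FinQuiver.{w}) (p : P.V) (q : Q.V) (r r' : R.V) :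
    Iso (FinQuiver.join b P p (FinQuiver.join b' Q q R r) (.inr r'))
      (FinQuiver.join b' Q q (FinQuiver.join b P p R r') (.inr r)) where
  onV := (Equiv.sumAssoc _ _ _).symm.trans
    ((Equiv.sumCongr (Equiv.sumComm _ _) (Equiv.refl _)).trans (Equiv.sumAssoc _ _ _))
  onA :=
    { toFun := fun
        | none => some (.inr none)
        | some (.inl a) => some (.inr (some (.inl a)))
        | some (.inr none) => none
        | some (.inr (some (.inl a))) => some (.inl a)
        | some (.inr (some (.inr a))) => some (.inr (some (.inr a)))
      invFun := fun
        | none => some (.inr none)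
        | some (.inr none) => none
        | some (.inr (some (.inl a))) => some (.inl a)
        | some (.inl a) => some (.inr (some (.inl a)))
        | some (.inr (some (.inr a))) => some (.inr (some (.inr a)))
      left_inv := by rintro (_ | a | _ | a | a) <;> rfl
      right_inv := by rintro (_ | a | _ | a | a) <;> rfl }
  t_onA := by rintro (_ | a | _ | a | a) <;> cases b <;> cases b' <;> rfl
  h_onA := by rintro (_ | a | _ | a | a) <;> cases b <;> cases b' <;> rfl

end Iso

end FinQuiver

namespace OTree

open FinQuiver

/-- A leaf may be attached anywhere: it is pushed down to the part of the join containing `v`, until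
a single point is reached. Preservation of the root lets the surrounding joins be rebuilt at the
same vertex. -/
theorem exists_iso_join_point (b : Bool) : ∀ (t : OTree) (v : t.toQuiver.1.V), ∃ (t' : OTree)
    (e : Iso.{w} (join b point PUnit.unit t.toQuiver.1 v) t'.toQuiver.1),
    e.onV (.inr t.toQuiver.2) = t'.toQuiver.2
  | nil, _ => ⟨cons b nil nil, Iso.refl _, rfl⟩
  | cons b' c r, .inl v => by
    obtain ⟨c', e, he⟩ := exists_iso_join_point b c v
    exact ⟨cons b' c' r, (Iso.joinLeft b b' point c.toQuiver.1 r.toQuiver.1 PUnit.unit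
      c.toQuiver.2 v r.toQuiver.2).trans (Iso.join b' e (Iso.refl _) he rfl), rfl⟩
  | cons b' c r, .inr v => by
    obtain ⟨r', e, he⟩ := exists_iso_join_point b r v
    exact ⟨cons b' c r', (Iso.joinRight b b' point c.toQuiver.1 r.toQuiver.1 PUnit.unit
      c.toQuiver.2 r.toQuiver.2 v).trans (Iso.join b' (Iso.refl _) e rfl he), congrArg Sum.inr he⟩

end OTree

namespace FinQuiver

/-! ### Tree quivers -/

/-- Removal of a vertex. -/
def removeVertex (Q : FinQuiver.{w}) (v : Q.V) : FinQuiver.{w} where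
  V := {x // x ≠ v}
  A := {a // Q.t a ≠ v ∧ Q.h a ≠ v}
  finite_V := by
    have := Q.finite_V
    infer_instance
  finite_A := by
    have := Q.finite_A
    infer_instance
  t a := ⟨Q.t a.1, a.2.1⟩
  h a := ⟨Q.h a.1, a.2.2⟩

theorem underlyingGraph_adj {Q : FinQuiver.{w}} {x y : Q.V} : Q.underlyingGraph.Adj x y ↔
    x ≠ y ∧ ∃ a, s(Q.t a, Q.h a) = s(x, y) := by
  simp only [underlyingGraph, SimpleGraph.fromRel_adj, Sym2.eq_iff, ← exists_or]

theorem IsTree.removeVertex {Q : FinQuiver.{w}} (hQ : Q.IsTree) {v : Q.V}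
    [Fintype (Q.underlyingGraph.neighborSet v)] (hv : Q.underlyingGraph.degree v = 1) :
    (Q.removeVertex v).IsTree := by
  obtain ⟨h₁, h₂, h₃⟩ := hQ
  refine ⟨fun a h => h₁ a.1 (congrArg Subtype.val h), fun a b hab => Subtype.ext (h₂ ?_), ?_⟩
  · exact congrArg (Sym2.map Subtype.val) hab
  · have : (Q.removeVertex v).underlyingGraph = Q.underlyingGraph.induce {v}ᶜ := by
      ext x y
      refine underlyingGraph_adj.trans (Iff.trans ?_ underlyingGraph_adj.symm)
      refine and_congr (not_congr Subtype.ext_iff) ⟨?_, ?_⟩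
      · rintro ⟨a, ha⟩
        exact ⟨a.1, congrArg (Sym2.map Subtype.val) ha⟩
      · rintro ⟨a, ha⟩
        have ht : Q.t a ≠ v ∧ Q.h a ≠ v := by
          rcases Sym2.eq_iff.mp ha with ⟨h, h'⟩ | ⟨h, h'⟩
          · exact ⟨h ▸ x.2, h' ▸ y.2⟩
          · exact ⟨h ▸ y.2, h' ▸ x.2⟩
        exact ⟨⟨a, ht⟩, Sym2.map.injective Subtype.val_injective ha⟩
    rw [this]
    exact ⟨h₃.1.induce_compl_singleton_of_degree_eq_one hv, h₃.2.induce _⟩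

/-- A leaf has one neighbour, and there are no loops or parallel arrows, so exactly one arrow `a₀`
meets `v`; it becomes the new arrow of the join. -/
theorem IsTree.exists_iso_join_point {Q : FinQuiver.{w}} (hQ : Q.IsTree) {v : Q.V}
    [Fintype (Q.underlyingGraph.neighborSet v)] (hv : Q.underlyingGraph.degree v = 1) :
    ∃ b u, Nonempty (Iso Q (join b point PUnit.unit (Q.removeVertex v) u)) := by
  obtain ⟨h₁, h₂, -⟩ := hQ
  obtain ⟨u, hu, huniq⟩ := SimpleGraph.degree_eq_one_iff_existsUnique_adj.mp hv
  obtain ⟨hne, a₀, ha₀⟩ := underlyingGraph_adj.mp hu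
  have hend : ∀ a, Q.t a = v ∨ Q.h a = v → a = a₀ := by
    rintro a (h | h)
    · have := huniq (Q.h a) (underlyingGraph_adj.mpr ⟨h ▸ h₁ a, a, by rw [h]⟩)
      exact h₂ (by simp only [h, this, ha₀])
    · have := huniq (Q.t a) (underlyingGraph_adj.mpr ⟨fun e => h₁ a (e.symm.trans h.symm), a, by
        rw [h, Sym2.eq_swap]⟩)
      exact h₂ (by simp only [h, this, ha₀, Sym2.eq_swap])
  have hb : ∃ b, Q.t a₀ = cond b v u ∧ Q.h a₀ = cond b u v := by
    rcases Sym2.eq_iff.mp ha₀ with ⟨h, h'⟩ | ⟨h, h'⟩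
    · exact ⟨true, h, h'⟩
    · exact ⟨false, h, h'⟩
  obtain ⟨b, hbt, hbh⟩ := hb
  have hav : Q.t a₀ = v ∨ Q.h a₀ = v := by
    cases b
    · exact Or.inr hbh
    · exact Or.inl hbt
  refine ⟨b, ⟨u, hne.symm⟩, ⟨Iso.symm ⟨Equiv.ofBijective (Sum.elim (fun _ => v) Subtype.val)
    ⟨?_, ?_⟩, Equiv.ofBijective (fun a => a.elim a₀ (Sum.elim PEmpty.elim Subtype.val))
    ⟨?_, ?_⟩, ?_, ?_⟩⟩⟩
  · rintro (⟨⟨⟩⟩ | x) (⟨⟨⟩⟩ | y) hxy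
    · rfl
    · exact absurd hxy.symm y.2
    · exact absurd hxy x.2
    · exact congrArg Sum.inr (Subtype.ext hxy)
  · intro x
    by_cases hx : x = v
    · exact ⟨.inl PUnit.unit, hx.symm⟩
    · exact ⟨.inr ⟨x, hx⟩, rfl⟩
  · have hne : ∀ a : (Q.removeVertex v).A, a.1 ≠ a₀ := by
      rintro ⟨a, h, h'⟩ rfl
      exact hav.elim h h'
    rintro (_ | ⟨⟨⟩⟩ | x) (_ | ⟨⟨⟩⟩ | y) hxy
    · rfl
    · exact absurd hxy.symm (hne y)
    · exact absurd hxy (hne x)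
    · exact congrArg (some ∘ Sum.inr) (Subtype.ext hxy)
  · intro a
    by_cases ha : Q.t a = v ∨ Q.h a = v
    · exact ⟨none, (hend a ha).symm⟩
    · exact ⟨some (.inr ⟨a, not_or.mp ha⟩), rfl⟩
  · rintro (_ | ⟨⟨⟩⟩ | a)
    · cases b
      · exact hbt
      · exact hbt
    · rfl
  · rintro (_ | ⟨⟨⟩⟩ | a)
    · cases b
      · exact hbh
      · exact hbh
    · rfl

/-- Induction on the number of vertices, removing a leaf and attaching it again on the side of
`OTree`. -/
theorem IsTree.exists_iso_toQuiver {Q : FinQuiver.{w}} (hQ : Q.IsTree) :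
    ∃ t : OTree, Nonempty (Iso Q t.toQuiver.1) := by
  classical
  induction hn : Nat.card Q.V using Nat.strong_induction_on generalizing Q with
  | _ n ih =>
    have := Q.finite_V
    have := Fintype.ofFinite Q.V
    rcases subsingleton_or_nontrivial Q.V with hs | hs
    · obtain ⟨x⟩ := hQ.2.2.1.nonempty
      have hA : ∀ a : Q.A, False := fun a => hQ.1 a (Subsingleton.elim _ _)
      exact ⟨.nil, ⟨⟨fun _ => PUnit.unit, fun _ => x, fun _ => Subsingleton.elim _ _, fun _ => rfl⟩,
        ⟨fun a => (hA a).elim, fun a => a.elim, fun a => (hA a).elim, fun a => a.elim⟩,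
        fun a => (hA a).elim, fun a => (hA a).elim⟩⟩
    · obtain ⟨v, hv⟩ := hQ.2.2.exists_vert_degree_one_of_nontrivial
      obtain ⟨b, u, ⟨e⟩⟩ := hQ.exists_iso_join_point hv
      obtain ⟨t, ⟨f⟩⟩ := ih _ (by
        rw [← hn]
        exact Finite.card_subtype_lt (p := fun x => x ≠ v) (x := v) (by simp)) (hQ.removeVertex hv) rfl
      obtain ⟨t', g, -⟩ := OTree.exists_iso_join_point b t (f.onV u)
      exact ⟨t', ⟨(e.trans (Iso.join b (Iso.refl _) f rfl rfl)).trans g⟩⟩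

theorem partiallyWellOrderedOn_isTree :
    {Q : FinQuiver.{w} | Q.IsTree}.PartiallyWellOrderedOn FinQuiver.IsMinor := by
  intro Q
  choose t e using fun n => (Q n).2.exists_iso_toQuiver
  obtain ⟨m, n, hmn, h⟩ := OTree.partiallyWellOrderedOn_emb fun n => ⟨t n, trivial⟩
  obtain ⟨e₁⟩ := e m
  obtain ⟨e₂⟩ := e n
  exact ⟨m, n, hmn, (e₁.isMinor.trans (OTree.Emb.isContraction h).isMinor).trans e₂.symm.isMinor⟩

/-! ### Quivers without a loop minor -/

/-- The quiver with one vertex and one arrow. -/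
def loop : FinQuiver.{w} where
  V := PUnit
  A := PUnit
  finite_V := inferInstance
  finite_A := inferInstance
  t := id
  h := id

theorem loop_isMinor {Q : FinQuiver.{w}} (a : Q.A)
    (h : Relation.EqvGen (Q.adjBy {a}ᶜ) (Q.t a) (Q.h a)) : loop.IsMinor Q :=
  isMinor_of_retraction {a}ᶜ (fun _ => Q.t a) (fun _ => a) (fun _ => ()) (fun _ _ => rfl)
    (fun _ _ _ => rfl) (fun _ _ _ => rfl)
    (fun _ h => h rfl) (fun _ => .refl _) (fun _ => .symm _ _ h)

/-- If the ends of an arrow are joined by a walk through the other arrows, contracting all the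
others turns it into a loop. Hence every arrow is a bridge, which excludes loops, parallel arrows
and cycles alike. -/
theorem isTree_of_isConn {Q : FinQuiver.{w}} [Nonempty Q.V] (hc : Q.IsConn)
    (hl : ¬ loop.IsMinor Q) : Q.IsTree := by
  have hl' : ∀ a, ¬ Relation.EqvGen (Q.adjBy {a}ᶜ) (Q.t a) (Q.h a) :=
    fun a h => hl (loop_isMinor a h)
  have h₁ : ∀ a, Q.t a ≠ Q.h a := fun a h => hl' a (h ▸ .refl _)
  refine ⟨h₁, fun a b hab => ?_, ⟨@SimpleGraph.Connected.mk _ _ (fun x y => ?_) _, ?_⟩⟩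
  · by_contra hne
    have hb : b ∈ ({a}ᶜ : Set Q.A) := fun h => hne (Set.mem_singleton_iff.mp h).symm
    rcases Sym2.eq_iff.mp hab with ⟨h, h'⟩ | ⟨h, h'⟩
    · exact hl' a (.rel _ _ ⟨b, hb, h.symm, h'.symm⟩)
    · exact hl' a (.symm _ _ (.rel _ _ ⟨b, hb, h'.symm, h.symm⟩))
  · induction hc x y with
    | rel x y h =>
      obtain ⟨a, -, rfl, rfl⟩ := h
      exact (underlyingGraph_adj.mpr ⟨h₁ a, a, rfl⟩).reachable
    | refl x => rfl
    | symm x y _ h => exact h.symm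
    | trans x y z _ _ h h' => exact h.trans h'
  · rw [SimpleGraph.isAcyclic_iff_forall_isBridge]
    intro e he
    induction e with
    | _ u v =>
    rw [SimpleGraph.isBridge_iff]
    obtain ⟨-, a, ha⟩ := underlyingGraph_adj.mp he
    have hwalk : ∀ x y, (Q.underlyingGraph.deleteEdges {s(u, v)}).Walk x y →
        Relation.EqvGen (Q.adjBy {a}ᶜ) x y := by
      intro x y p
      induction p with
      | nil => exact .refl _
      | cons h p ih =>
        refine .trans _ _ _ ?_ ih
        rw [SimpleGraph.deleteEdges_adj, underlyingGraph_adj] at h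
        obtain ⟨⟨-, b, hb⟩, hne⟩ := h
        have hba : b ∈ ({a}ᶜ : Set Q.A) := by
          rintro rfl
          exact hne (hb.symm.trans ha)
        rcases Sym2.eq_iff.mp hb with ⟨h, h'⟩ | ⟨h, h'⟩
        · exact .rel _ _ ⟨b, hba, h, h'⟩
        · exact .symm _ _ (.rel _ _ ⟨b, hba, h, h'⟩)
    rintro ⟨p⟩
    have key := hwalk u v p
    rcases Sym2.eq_iff.mp ha with ⟨h, h'⟩ | ⟨h, h'⟩
    · exact hl' a (h ▸ h' ▸ key)
    · exact hl' a (h ▸ h' ▸ .symm _ _ key)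

/-- The connected component of a quiver. -/
def component (Q : FinQuiver.{w}) (κ : Quot (Q.adjBy Set.univ)) : FinQuiver.{w} where
  V := {x // Quot.mk (Q.adjBy Set.univ) x = κ}
  A := {a // Quot.mk (Q.adjBy Set.univ) (Q.t a) = κ}
  finite_V := by
    have := Q.finite_V
    infer_instance
  finite_A := by
    have := Q.finite_A
    infer_instance
  t a := ⟨Q.t a.1, a.2⟩
  h a := ⟨Q.h a.1, (Quot.sound ⟨a.1, Set.mem_univ _, rfl, rfl⟩).symm.trans a.2⟩

/-- The inclusion of a connected component. -/
def componentEmbedding (Q : FinQuiver.{w}) (κ : Quot (Q.adjBy Set.univ)) :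
    Embedding (Q.component κ) Q where
  onV := Subtype.val
  onA := Subtype.val
  onV_injective := Subtype.val_injective
  onA_injective := Subtype.val_injective
  t_onA _ := rfl
  h_onA _ := rfl

theorem isTree_component {Q : FinQuiver.{w}} (hl : ¬ loop.IsMinor Q)
    (κ : Quot (Q.adjBy Set.univ)) : (Q.component κ).IsTree := by
  have : Nonempty (Q.component κ).V := ⟨⟨_, Quot.out_eq κ⟩⟩
  refine isTree_of_isConn ?_ fun h => hl (h.trans (Q.componentEmbedding κ).isMinor)
  rintro ⟨x, hx⟩ ⟨y, hy⟩
  have hxy := Quot.eqvGen_exact (hx.trans hy.symm)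
  induction hxy with
  | rel x y h =>
    obtain ⟨a, -, rfl, rfl⟩ := h
    exact .rel _ _ ⟨⟨a, hx⟩, Set.mem_univ _, rfl, rfl⟩
  | refl x => exact .refl _
  | symm x y _ h => exact .symm _ _ (h hy hx)
  | trans x y z h _ ih ih' =>
    have hy' := (Quot.eqvGen_sound h).symm.trans hx
    exact .trans _ _ _ (ih hx hy') (ih' hy' hy)

end FinQuiver

namespace QuiverRep

variable {K : Type u} [Field K] {Q : FinQuiver.{w}}

/-! ### Cancellation of direct summands -/

/-- A family of linear maps is a homomorphism of representations. -/
def IsHom {X Y : QuiverRep K Q} (f : ∀ x, X.obj x →ₗ[K] Y.obj x) : Prop :=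
  ∀ a v, f (Q.h a) (X.map a v) = Y.map a (f (Q.t a) v)

section IsHom

variable {X Y Z : QuiverRep K Q}

theorem IsHom.comp {g : ∀ x, Y.obj x →ₗ[K] Z.obj x} {f : ∀ x, X.obj x →ₗ[K] Y.obj x}
    (hg : IsHom g) (hf : IsHom f) : IsHom fun x => g x ∘ₗ f x := fun a v => by
  simp only [LinearMap.comp_apply, hf a, hg a]

theorem IsHom.add {f g : ∀ x, X.obj x →ₗ[K] Y.obj x} (hf : IsHom f) (hg : IsHom g) :
    IsHom fun x => f x + g x := fun a v => by
  simp only [LinearMap.add_apply, hf a, hg a, map_add]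

theorem IsHom.sub {f g : ∀ x, X.obj x →ₗ[K] Y.obj x} (hf : IsHom f) (hg : IsHom g) :
    IsHom fun x => f x - g x := fun a v => by
  simp only [LinearMap.sub_apply, hf a, hg a, map_sub]

theorem IsHom.id : IsHom fun x => (LinearMap.id : X.obj x →ₗ[K] X.obj x) := fun _ _ => rfl

theorem IsHom.pow {f : ∀ x, X.obj x →ₗ[K] X.obj x} (hf : IsHom f) (n : ℕ) :
    IsHom fun x => f x ^ n := by
  induction n with
  | zero => exact fun _ _ => rfl
  | succ n ih =>
    intro a v
    simp only [pow_succ, Module.End.mul_apply]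
    rw [hf a, ih a]

theorem IsHom.exists_inverse {f : ∀ x, X.obj x →ₗ[K] Y.obj x} (hf : IsHom f)
    (hb : ∀ x, Function.Bijective (f x)) : ∃ g : ∀ x, Y.obj x →ₗ[K] X.obj x, IsHom g ∧
      (∀ x v, f x (g x v) = v) ∧ ∀ x v, g x (f x v) = v := by
  let e x := LinearEquiv.ofBijective (f x) (hb x)
  have h₁ : ∀ x v, f x ((e x).symm v) = v := fun x v => (e x).apply_symm_apply v
  refine ⟨fun x => (e x).symm, fun a v => (hb _).1 ?_, h₁, fun x v => (e x).symm_apply_apply v⟩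
  change f _ ((e _).symm _) = f _ (X.map a ((e _).symm v))
  rw [h₁, hf a, h₁]

theorem IsHom.nonempty_iso {f : ∀ x, X.obj x →ₗ[K] Y.obj x} (hf : IsHom f)
    (hb : ∀ x, Function.Bijective (f x)) : Nonempty (Iso X Y) :=
  ⟨⟨fun x => LinearEquiv.ofBijective (f x) (hb x), hf⟩⟩

end IsHom

/-- The subrepresentation on a family of stable subspaces. -/
def sub (X : QuiverRep K Q) (p : ∀ x, Submodule K (X.obj x))
    (hp : ∀ a, ∀ v ∈ p (Q.t a), X.map a v ∈ p (Q.h a)) : QuiverRep K Q where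
  obj x := p x
  map a := (X.map a).restrict (hp a)

theorem sub_dirSum_sub (X : QuiverRep K Q) (p q : ∀ x, Submodule K (X.obj x))
    (hp : ∀ a, ∀ v ∈ p (Q.t a), X.map a v ∈ p (Q.h a))
    (hq : ∀ a, ∀ v ∈ q (Q.t a), X.map a v ∈ q (Q.h a)) (hpq : ∀ x, IsCompl (p x) (q x)) :
    Nonempty (Iso ((X.sub p hp).dirSum (X.sub q hq)) X) := by
  refine ⟨⟨fun x => Submodule.prodEquivOfIsCompl (p x) (q x) (hpq x), ?_⟩⟩
  rintro a ⟨v, v'⟩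
  exact (map_add (X.map a) v.1 v'.1).symm

/-- A representation is indecomposable (or zero) if it has no proper splitting. -/
def IsIndec (X : QuiverRep K Q) : Prop :=
  ∀ p q : ∀ x, Submodule K (X.obj x), (∀ a, ∀ v ∈ p (Q.t a), X.map a v ∈ p (Q.h a)) →
    (∀ a, ∀ v ∈ q (Q.t a), X.map a v ∈ q (Q.h a)) → (∀ x, IsCompl (p x) (q x)) →
    p = ⊤ ∨ q = ⊤

/-- Fitting's lemma: the kernel and range of a high power of `f` split `X`. -/
theorem IsIndec.nilpotent_or_bijective {X : QuiverRep K Q} (hX : X.IsIndec)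
    {f : ∀ x, X.obj x →ₗ[K] X.obj x} (hf : IsHom f) :
    (∃ n, ∀ x, f x ^ n = 0) ∨ ∀ x, Function.Bijective (f x) := by
  have := Q.finite_V
  -- One exponent serves all the finitely many vertices; `1 ≤ n` is needed to deduce surjectivity of
  -- `f x` from that of its power.
  obtain ⟨n, hn, hn1⟩ := ((Filter.eventually_all.mpr fun x : Q.V =>
    LinearMap.eventually_isCompl_ker_pow_range_pow (f x)).and (Filter.eventually_ge_atTop 1)).exists
  have hfn := hf.pow n
  have hker : ∀ a, ∀ v ∈ LinearMap.ker (f (Q.t a) ^ n),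
      X.map a v ∈ LinearMap.ker (f (Q.h a) ^ n) := by
    intro a v hv
    rw [LinearMap.mem_ker] at hv ⊢
    rw [hfn a, hv, map_zero]
  have hrange : ∀ a, ∀ v ∈ LinearMap.range (f (Q.t a) ^ n),
      X.map a v ∈ LinearMap.range (f (Q.h a) ^ n) := by
    rintro a _ ⟨v, rfl⟩
    exact ⟨X.map a v, hfn a v⟩
  rcases hX _ _ hker hrange hn with h | h
  · exact Or.inl ⟨n, fun x => LinearMap.ker_eq_top.mp (congrFun h x)⟩
  · refine Or.inr fun x => ?_
    have hs : Function.Surjective (f x) := by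
      have := LinearMap.range_eq_top.mp (congrFun h x)
      obtain ⟨m, rfl⟩ := Nat.exists_eq_add_of_le' hn1
      rw [pow_succ', Module.End.mul_eq_comp, LinearMap.coe_comp] at this
      exact this.of_comp
    exact ⟨LinearMap.injective_iff_surjective.mpr hs, hs⟩

/-- Write the isomorphism as a block matrix with rows `(α, β)` and `(c, d)`. If the corner `d` were
invertible, the Schur complement would be an isomorphism from `X` to `Y`. In general a shear by some
`u` replaces the corner by `d + c u`, and Fitting's lemma provides a `u` making it invertible. -/
theorem nonempty_iso_of_indec {X Y Z : QuiverRep K Q} (hZ : Z.IsIndec)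
    (e : Iso (X.dirSum Z) (Y.dirSum Z)) : Nonempty (Iso X Y) := by
  obtain ⟨ψ, hψ⟩ : ∃ ψ : ∀ x, (X.obj x × Z.obj x) ≃ₗ[K] (Y.obj x × Z.obj x), ∀ a v w,
      ψ (Q.h a) (X.map a v, Z.map a w) =
        (Y.map a (ψ (Q.t a) (v, w)).1, Z.map a (ψ (Q.t a) (v, w)).2) :=
    ⟨e.equiv, fun a v w => e.comm a (v, w)⟩
  have hψ' : ∀ a v w, (ψ (Q.h a)).symm (Y.map a v, Z.map a w) =
      (X.map a ((ψ (Q.t a)).symm (v, w)).1, Z.map a ((ψ (Q.t a)).symm (v, w)).2) := by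
    intro a v w
    rw [LinearEquiv.symm_apply_eq, hψ]
    simp
  let α x : X.obj x →ₗ[K] Y.obj x := LinearMap.fst K _ _ ∘ₗ (ψ x).toLinearMap ∘ₗ LinearMap.inl K _ _
  let β x : Z.obj x →ₗ[K] Y.obj x := LinearMap.fst K _ _ ∘ₗ (ψ x).toLinearMap ∘ₗ LinearMap.inr K _ _
  let c x : X.obj x →ₗ[K] Z.obj x := LinearMap.snd K _ _ ∘ₗ (ψ x).toLinearMap ∘ₗ LinearMap.inl K _ _
  let d x : Z.obj x →ₗ[K] Z.obj x := LinearMap.snd K _ _ ∘ₗ (ψ x).toLinearMap ∘ₗ LinearMap.inr K _ _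
  let b' x : Z.obj x →ₗ[K] X.obj x :=
    LinearMap.fst K _ _ ∘ₗ (ψ x).symm.toLinearMap ∘ₗ LinearMap.inr K _ _
  let d' x : Z.obj x →ₗ[K] Z.obj x :=
    LinearMap.snd K _ _ ∘ₗ (ψ x).symm.toLinearMap ∘ₗ LinearMap.inr K _ _
  have hψe : ∀ x v w, ψ x (v, w) = (α x v + β x w, c x v + d x w) := by
    intro x v w
    have : ((v, w) : X.obj x × Z.obj x) = (v, 0) + (0, w) := by simp
    rw [this, map_add]
    rfl
  have hα : IsHom α := fun a v => by
    have := congrArg Prod.fst (hψ a v 0)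
    rwa [map_zero] at this
  have hβ : IsHom β := fun a v => by
    have := congrArg Prod.fst (hψ a 0 v)
    rwa [map_zero] at this
  have hc : IsHom c := fun a v => by
    have := congrArg Prod.snd (hψ a v 0)
    rwa [map_zero] at this
  have hd : IsHom d := fun a v => by
    have := congrArg Prod.snd (hψ a 0 v)
    rwa [map_zero] at this
  have hb' : IsHom b' := fun a v => by
    have := congrArg Prod.fst (hψ' a 0 v)
    rwa [map_zero] at this
  have hd' : IsHom d' := fun a v => by
    have := congrArg Prod.snd (hψ' a 0 v)
    rwa [map_zero] at this
  have hone : ∀ x z, c x (b' x z) + d x (d' x z) = z := by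
    intro x z
    have h := (ψ x).apply_symm_apply (0, z)
    have h' : (ψ x).symm (0, z) = (b' x z, d' x z) := rfl
    rw [h', hψe] at h
    exact congrArg Prod.snd h
  -- Here `c b' + d d' = 1`. If `c b'` is nilpotent, then `d d'` is a unit and `d` is already
  -- bijective. If `c b'` has an inverse `g`, then `u = b' g (1 - d)` gives `d + c u = 1`.
  obtain ⟨u, hu, hD⟩ : ∃ u : ∀ x, Z.obj x →ₗ[K] X.obj x, IsHom u ∧
      ∀ x, Function.Bijective (d x + c x ∘ₗ u x) := by
    by_cases hdb : ∀ x, Function.Bijective (d x)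
    · exact ⟨fun _ => 0, fun a v => (map_zero (X.map a)).symm, by simpa using hdb⟩
    rcases hZ.nilpotent_or_bijective (hc.comp hb') with ⟨n, hn⟩ | hb
    · refine absurd (fun x => ?_) hdb
      have hunit : IsUnit (d x * d' x) := by
        have h : d x * d' x = 1 - c x ∘ₗ b' x := by
          ext z
          exact eq_sub_of_add_eq' (hone x z)
        rw [h]
        exact IsNilpotent.isUnit_one_sub ⟨n, hn x⟩
      have hs : Function.Surjective (d x) := by
        have := ((Module.End.isUnit_iff _).mp hunit).2
        rw [Module.End.mul_eq_comp, LinearMap.coe_comp] at this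
        exact this.of_comp
      exact ⟨LinearMap.injective_iff_surjective.mpr hs, hs⟩
    · obtain ⟨g, hg, hg₁, -⟩ := (hc.comp hb').exists_inverse hb
      refine ⟨fun x => b' x ∘ₗ g x ∘ₗ (LinearMap.id - d x),
        hb'.comp (hg.comp (IsHom.id.sub hd)), fun x => ?_⟩
      have h : d x + c x ∘ₗ b' x ∘ₗ g x ∘ₗ (LinearMap.id - d x) = LinearMap.id := by
        ext z
        have := hg₁ x (z - d x z)
        simp only [LinearMap.comp_apply] at this
        simp [-map_sub, this]
      rw [h]
      exact Function.bijective_id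
  obtain ⟨E, hE, hE₁, -⟩ := (hd.add (hc.comp hu)).exists_inverse hD
  have hE₂ : ∀ x w, d x (E x w) + c x (u x (E x w)) = w := hE₁
  refine IsHom.nonempty_iso (f := fun x => α x - (α x ∘ₗ u x + β x) ∘ₗ E x ∘ₗ c x)
    (hα.sub (((hα.comp hu).add hβ).comp (hE.comp hc))) fun x => ?_
  -- The vectors that `ψ` sends into the summand `Y`, parametrized by `v`: bijectivity of the Schur
  -- complement is read off from that of `ψ`.
  have hval : ∀ v, ψ x (v - u x (E x (c x v)), - E x (c x v)) =
      ((α x - (α x ∘ₗ u x + β x) ∘ₗ E x ∘ₗ c x) v, 0) := by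
    intro v
    rw [hψe]
    refine Prod.ext ?_ ?_
    · simp only [map_sub, map_neg, LinearMap.sub_apply, LinearMap.add_apply, LinearMap.comp_apply]
      abel
    · have := hE₂ x (c x v)
      simp only [map_sub, map_neg]
      nth_rewrite 1 [← this]
      abel
  constructor
  · rw [injective_iff_map_eq_zero]
    intro v hv
    have h := hval v
    rw [hv] at h
    have h0 := (ψ x).map_eq_zero_iff.mp h
    rw [Prod.mk_eq_zero, neg_eq_zero] at h0
    simpa [h0.2] using h0.1
  · intro y
    obtain ⟨⟨s, w⟩, hs⟩ := (ψ x).surjective (y, 0)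
    refine ⟨s - u x w, ?_⟩
    rw [hψe] at hs
    have h2 : c x s + d x w = 0 := congrArg Prod.snd hs
    have hw : E x (c x (s - u x w)) = - w := by
      apply (hD x).1
      have h3 : (d x + c x ∘ₗ u x) (E x (c x (s - u x w))) = c x (s - u x w) := hE₁ x _
      rw [h3]
      simp only [map_sub, map_neg, LinearMap.add_apply, LinearMap.comp_apply]
      rw [eq_neg_of_add_eq_zero_left h2]
      abel
    have h := hval (s - u x w)
    rw [hw, hψe] at h
    rw [Prod.mk.injEq] at h hs
    rw [← h.1, ← hs.1]
    simp

namespace IsoClass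

/-- The class of the zero representation. -/
instance : Zero (IsoClass K Q) where
  zero := Quotient.mk _ { obj := fun _ => PUnit, map := fun _ => 0 }

/-- The isomorphism classes form a commutative monoid under the direct sum. -/
instance : AddCommMonoid (IsoClass K Q) where
  add_assoc := by
    rintro ⟨X⟩ ⟨Y⟩ ⟨Z⟩
    exact Quotient.sound ⟨⟨fun x => LinearEquiv.prodAssoc K _ _ _, fun a v => rfl⟩⟩
  zero_add := by
    rintro ⟨X⟩
    exact Quotient.sound ⟨⟨fun x => LinearEquiv.uniqueProd, fun a v => rfl⟩⟩
  add_zero := by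
    rintro ⟨X⟩
    exact Quotient.sound ⟨⟨fun x => LinearEquiv.prodUnique, fun a v => rfl⟩⟩
  add_comm := by
    rintro ⟨X⟩ ⟨Y⟩
    exact Quotient.sound ⟨⟨fun x => LinearEquiv.prodComm K _ _, fun a v => rfl⟩⟩
  nsmul := nsmulRec

/-- The isomorphism class of a representation. -/
def mk (X : QuiverRep K Q) : IsoClass K Q := Quotient.mk _ X

theorem ind {p : IsoClass K Q → Prop} (h : ∀ X, p (mk X)) (X : IsoClass K Q) : p X :=
  Quotient.ind h X

theorem mk_eq_mk {X Y : QuiverRep K Q} : mk X = mk Y ↔ Nonempty (Iso X Y) := Quotient.eq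

theorem mk_dirSum (X Y : QuiverRep K Q) : mk (X.dirSum Y) = mk X + mk Y := rfl

/-- Induction on the total dimension of `Z`: a proper splitting lets its two smaller summands be
cancelled one after the other. -/
theorem add_right_cancel_mk (Z : QuiverRep K Q) (X Y : IsoClass K Q)
    (h : X + mk Z = Y + mk Z) : X = Y := by
  have := Q.finite_V
  have := Fintype.ofFinite Q.V
  induction hn : ∑ x, Module.finrank K (Z.obj x) using Nat.strong_induction_on
    generalizing Z X Y with
  | _ n ih =>
    by_cases hZ : Z.IsIndec
    · induction X using ind with | _ X
      induction Y using ind with | _ Y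
      rw [← mk_dirSum, ← mk_dirSum, mk_eq_mk] at h
      exact mk_eq_mk.mpr (nonempty_iso_of_indec hZ h.some)
    · simp only [IsIndec, not_forall, not_or] at hZ
      obtain ⟨p, q, hp, hq, hpq, hp', hq'⟩ := hZ
      have hlt : ∀ (p : ∀ x, Submodule K (Z.obj x))
          (hp : ∀ a, ∀ v ∈ p (Q.t a), Z.map a v ∈ p (Q.h a)), p ≠ ⊤ →
          ∑ x, Module.finrank K ((Z.sub p hp).obj x) < n := by
        intro p hp hne
        rw [← hn]
        obtain ⟨x, hx⟩ := Function.ne_iff.mp hne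
        exact Finset.sum_lt_sum (fun x _ => Submodule.finrank_le (p x))
          ⟨x, Finset.mem_univ _, Submodule.finrank_lt hx⟩
      have hz : mk Z = mk (Z.sub p hp) + mk (Z.sub q hq) :=
        (mk_eq_mk.mpr (Z.sub_dirSum_sub p q hp hq hpq)).symm
      rw [hz, ← add_assoc, ← add_assoc] at h
      exact ih _ (hlt p hp hp') _ _ _ (ih _ (hlt q hq hq') _ _ _ h rfl) rfl

instance : IsCancelAdd (IsoClass K Q) :=
  have : IsRightCancelAdd (IsoClass K Q) := ⟨fun Z X Y h => by
    induction Z using ind with | _ Z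
    exact add_right_cancel_mk Z X Y h⟩
  AddCommMagma.IsRightCancelAdd.toIsCancelAdd _

end IsoClass

/-! ### Elements of the representation ring -/

/-- The class of a representation in the representation ring. -/
noncomputable def cls (X : IsoClass K Q) : RepRing K Q :=
  Ideal.Quotient.mk _ (MonoidAlgebra.of ℤ _ X)

theorem cls_add (X Y : IsoClass K Q) : cls (X + Y) = cls X + cls Y := by
  rw [cls, cls, cls, ← map_add, eq_comm, Ideal.Quotient.eq]
  exact AddSubgroup.subset_closure ⟨X, Y, rfl⟩

theorem exists_eq_cls_sub (r : RepRing K Q) : ∃ X Y : IsoClass K Q, r = cls X - cls Y := by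
  obtain ⟨r, rfl⟩ := Ideal.Quotient.mk_surjective r
  have hz : cls (0 : IsoClass K Q) = 0 := by simpa using cls_add (0 : IsoClass K Q) 0
  have hadd : ∀ r s : RepRing K Q, (∃ X Y : IsoClass K Q, r = cls X - cls Y) →
      (∃ X Y : IsoClass K Q, s = cls X - cls Y) → ∃ X Y : IsoClass K Q, r + s = cls X - cls Y := by
    rintro _ _ ⟨X, Y, rfl⟩ ⟨X', Y', rfl⟩
    exact ⟨X + X', Y + Y', by rw [cls_add, cls_add]; abel⟩
  have hneg : ∀ r : RepRing K Q, (∃ X Y : IsoClass K Q, r = cls X - cls Y) →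
      ∃ X Y : IsoClass K Q, -r = cls X - cls Y := by
    rintro _ ⟨X, Y, rfl⟩
    exact ⟨Y, X, by abel⟩
  induction r using MonoidAlgebra.induction_on with
  | of X => exact ⟨X, 0, by rw [hz, sub_zero]; rfl⟩
  | add r s hr hs => rw [map_add]; exact hadd _ _ hr hs
  | smul n r hr =>
    rw [map_zsmul]
    induction n using Int.induction_on with
    | zero => exact ⟨0, 0, by simp⟩
    | succ n ih => rw [add_zsmul, one_zsmul]; exact hadd _ _ ih hr
    | pred n ih => rw [sub_eq_add_neg, add_zsmul, neg_one_zsmul]; exact hadd _ _ ih (hneg _ hr)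

/-- Additively, the relators die in the Grothendieck group of the monoid of isomorphism classes, and
a cancellative monoid embeds in its Grothendieck group. -/
theorem cls_injective : Function.Injective (cls : IsoClass K Q → RepRing K Q) := by
  intro X Y h
  let φ : MonoidAlgebra ℤ (IsoClass K Q) →+ Algebra.GrothendieckAddGroup (IsoClass K Q) :=
    (Finsupp.linearCombination ℤ
      (Algebra.GrothendieckAddGroup.of (M := IsoClass K Q))).toAddMonoidHom.comp
      MonoidAlgebra.coeffAddEquiv.toAddMonoidHom
  have hφ : ∀ X, φ (MonoidAlgebra.of ℤ _ X) = Algebra.GrothendieckAddGroup.of X := fun X =>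
    (Finsupp.linearCombination_single ℤ 1 X).trans (one_zsmul _)
  have hker : ∀ r ∈ AddSubgroup.closure (relators K Q), φ r = 0 := by
    intro r hr
    refine (AddSubgroup.closure_le φ.ker).mpr ?_ hr
    rintro _ ⟨X, Y, rfl⟩
    change φ _ = 0
    rw [map_sub, map_add, hφ, hφ, hφ, map_add, sub_self]
  have h0 := hker _ (Ideal.Quotient.eq.mp h)
  rw [map_sub, hφ, hφ, sub_eq_zero] at h0
  exact Algebra.GrothendieckAddGroup.of_injective h0

end QuiverRep

/-! ### Reductions of commutative rings and finiteness -/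

theorem Module.Finite.reduction_of_surjective {R S : Type*} [CommRing R] [CommRing S]
    (φ : R →+* S) (hφ : Function.Surjective φ) (h : Module.Finite ℤ (R ⧸ nilradical R)) :
    Module.Finite ℤ (S ⧸ nilradical S) := by
  have hle : nilradical R ≤ (nilradical S).comap φ := fun x hx => by
    rw [mem_nilradical] at hx
    exact mem_nilradical.mpr (hx.map φ)
  exact Module.Finite.of_surjective
    (Ideal.quotientMap (nilradical S) φ hle).toAddMonoidHom.toIntLinearMap
    (Ideal.quotientMap_surjective (H := hle) hφ)

/-- A jointly injective finite family stays so on reductions: if every image of `r` is nilpotent,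
the sum of the exponents kills `r`. The reduction of `R` is thus a subgroup of a finitely generated
abelian group. -/
theorem Module.Finite.reduction_of_injective {ι R : Type*} [Finite ι] [CommRing R]
    {S : ι → Type*} [∀ i, CommRing (S i)] (φ : ∀ i, R →+* S i)
    (hφ : ∀ r, (∀ i, φ i r = 0) → r = 0)
    (h : ∀ i, Module.Finite ℤ (S i ⧸ nilradical (S i))) :
    Module.Finite ℤ (R ⧸ nilradical R) := by
  have hle : ∀ i, nilradical R ≤ (nilradical (S i)).comap (φ i) := fun i x hx => by
    rw [mem_nilradical] at hx
    exact mem_nilradical.mpr (hx.map (φ i))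
  let ψ : R ⧸ nilradical R →+* ∀ i, S i ⧸ nilradical (S i) :=
    RingHom.pi fun i => Ideal.quotientMap _ (φ i) (hle i)
  refine Module.Finite.of_injective ψ.toAddMonoidHom.toIntLinearMap
    ((injective_iff_map_eq_zero ψ).mpr fun r hr => ?_)
  obtain ⟨r, rfl⟩ := Ideal.Quotient.mk_surjective r
  have hnil : ∀ i, IsNilpotent (φ i r) := fun i =>
    mem_nilradical.mp (Ideal.Quotient.eq_zero_iff_mem.mp (congrFun hr i))
  choose n hn using hnil
  have := Fintype.ofFinite ι
  refine Ideal.Quotient.eq_zero_iff_mem.mpr ⟨∑ i, n i, hφ _ fun i => ?_⟩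
  rw [map_pow]
  exact pow_eq_zero_of_le (Finset.single_le_sum (fun _ _ => Nat.zero_le _) (Finset.mem_univ i)) (hn i)

/-! ### Maps of quivers and pullback of representations -/

namespace FinQuiver

/-- Either an arrow from `x` to `y`, or an equality of `x` and `y`. -/
inductive Step (Q : FinQuiver.{w}) (x y : Q.V) : Type w
  | arrow (a : Q.A) (ht : Q.t a = x) (hh : Q.h a = y)
  | id (h : x = y)

/-- A map of quivers that may send arrows to identities. -/
structure Morphism (P Q : FinQuiver.{w}) where
  onV : P.V → Q.V
  onA : ∀ a, Q.Step (onV (P.t a)) (onV (P.h a))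

/-- An embedding as a map of quivers. -/
def Embedding.toMorphism {P Q : FinQuiver.{w}} (e : Embedding P Q) : Morphism P Q where
  onV := e.onV
  onA a := .arrow (e.onA a) (e.t_onA a) (e.h_onA a)

open Classical in
/-- The map from a quiver to its contraction. -/
noncomputable def toContract (Q : FinQuiver.{w}) (C : Set Q.A) : Morphism Q (Q.contract C) where
  onV := Quot.mk _
  onA a := if h : a ∈ C then .id (Quot.sound ⟨a, h, rfl, rfl⟩) else .arrow ⟨a, h⟩ rfl rfl

end FinQuiver

namespace QuiverRep

variable {K : Type u} [Field K] {P Q : FinQuiver.{w}}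

open FinQuiver

/-- A ring homomorphism from the representation ring, from its values on representations. -/
noncomputable def liftRing {R : Type*} [CommRing R] (φ : IsoClass K Q →* R)
    (hφ : ∀ X Y, φ (X + Y) = φ X + φ Y) : RepRing K Q →+* R :=
  Ideal.Quotient.lift _ (MonoidAlgebra.lift ℤ R (IsoClass K Q) φ).toRingHom fun r hr => by
    refine (AddSubgroup.closure_le
      (MonoidAlgebra.lift ℤ R (IsoClass K Q) φ).toRingHom.toAddMonoidHom.ker).mpr ?_ hr
    rintro _ ⟨X, Y, rfl⟩
    change MonoidAlgebra.lift ℤ R (IsoClass K Q) φ _ = 0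
    rw [map_sub, map_add, MonoidAlgebra.lift_of, MonoidAlgebra.lift_of, MonoidAlgebra.lift_of, hφ,
      sub_self]

theorem liftRing_cls {R : Type*} [CommRing R] (φ : IsoClass K Q →* R)
    (hφ : ∀ X Y, φ (X + Y) = φ X + φ Y) (X : IsoClass K Q) : liftRing φ hφ (cls X) = φ X :=
  MonoidAlgebra.lift_of φ X

/-- The action of a step on a representation. -/
def stepMap (X : QuiverRep K Q) : ∀ {x y : Q.V}, Q.Step x y → (X.obj x →ₗ[K] X.obj y)
  | _, _, .arrow a rfl rfl => X.map a
  | _, _, .id rfl => LinearMap.id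

theorem stepMap_iso {X Y : QuiverRep K Q} (e : Iso X Y) {x y : Q.V} (s : Q.Step x y) (v : X.obj x) :
    e.equiv y (X.stepMap s v) = Y.stepMap s (e.equiv x v) := by
  rcases s with ⟨a, rfl, rfl⟩ | ⟨rfl⟩
  · exact e.comm a v
  · rfl

theorem stepMap_dirSum (X Y : QuiverRep K Q) {x y : Q.V} (s : Q.Step x y) :
    (X.dirSum Y).stepMap s = (X.stepMap s).prodMap (Y.stepMap s) := by
  rcases s with ⟨a, rfl, rfl⟩ | ⟨rfl⟩ <;> rfl

theorem stepMap_tensor (X Y : QuiverRep K Q) {x y : Q.V} (s : Q.Step x y) :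
    (X.tensor Y).stepMap s = TensorProduct.map (X.stepMap s) (Y.stepMap s) := by
  rcases s with ⟨a, rfl, rfl⟩ | ⟨rfl⟩
  · rfl
  · exact TensorProduct.map_id.symm

theorem stepMap_unit {x y : Q.V} (s : Q.Step x y) (v : K) : (unit K Q).stepMap s v = v := by
  rcases s with ⟨a, rfl, rfl⟩ | ⟨rfl⟩ <;> rfl

/-- The pullback of a representation along a map of quivers. -/
def pull (f : Morphism P Q) (X : QuiverRep K Q) : QuiverRep K P where
  obj x := X.obj (f.onV x)
  map a := X.stepMap (f.onA a)

/-- The pullback of isomorphism classes. -/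
noncomputable def pullClass (f : Morphism P Q) : IsoClass K Q →* IsoClass K P where
  toFun := Quotient.map (pull f) fun _ _ ⟨e⟩ =>
    ⟨⟨fun x => e.equiv (f.onV x), fun a v => stepMap_iso e (f.onA a) v⟩⟩
  map_one' := Quotient.sound (s := isoSetoid K P) (a := (unit K Q).pull f) (b := unit K P)
    ⟨⟨fun _ => LinearEquiv.refl K K, fun a v =>
      stepMap_unit (K := K) (Q := Q) (f.onA a) v⟩⟩
  map_mul' := by
    rintro ⟨X⟩ ⟨Y⟩
    exact Quotient.sound ⟨⟨fun _ => LinearEquiv.refl K _, fun a v =>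
      LinearMap.congr_fun (stepMap_tensor X Y (f.onA a)) v⟩⟩

theorem pullClass_mk (f : Morphism P Q) (X : QuiverRep K Q) :
    pullClass f (IsoClass.mk X) = IsoClass.mk (X.pull f) := rfl

theorem pullClass_add (f : Morphism P Q) (X Y : IsoClass K Q) :
    pullClass f (X + Y) = pullClass f X + pullClass f Y := by
  obtain ⟨X⟩ := X
  obtain ⟨Y⟩ := Y
  exact Quotient.sound ⟨⟨fun _ => LinearEquiv.refl K _, fun a v =>
    LinearMap.congr_fun (stepMap_dirSum X Y (f.onA a)) v⟩⟩

/-- The class of a representation, as a multiplicative map. -/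
noncomputable def clsHom (K : Type u) [Field K] (Q : FinQuiver.{w}) : IsoClass K Q →* RepRing K Q :=
  (Ideal.Quotient.mk _).toMonoidHom.comp (MonoidAlgebra.of ℤ _)

/-- The pullback homomorphism between representation rings. -/
noncomputable def pullRing (f : Morphism P Q) : RepRing K Q →+* RepRing K P :=
  liftRing ((clsHom K P).comp (pullClass f)) fun X Y =>
    (congrArg cls (pullClass_add f X Y)).trans (cls_add _ _)

theorem pullRing_cls (f : Morphism P Q) (X : IsoClass K Q) :
    pullRing f (cls X) = cls (pullClass f X) := liftRing_cls _ _ _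

/-! ### Minors -/

/-- Extension by zero: zero spaces and zero maps outside the image of `e`. -/
theorem exists_pull_iso_of_embedding (e : Embedding P Q) (Y : QuiverRep K P) :
    ∃ X : QuiverRep K Q, Nonempty (Iso (X.pull e.toMorphism) Y) := by
  classical
  -- Bundled modules allow `Function.extend` to carry the module structures along with the spaces.
  let M : Q.V → FGModuleCat.{u} K :=
    Function.extend e.onV (fun v => FGModuleCat.of K (Y.obj v)) fun _ => FGModuleCat.of K PUnit
  have hM : ∀ {v x}, e.onV v = x → M x = FGModuleCat.of K (Y.obj v) := by
    rintro v _ rfl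
    exact e.onV_injective.extend_apply _ _ _
  have toEquiv : ∀ {A B : FGModuleCat.{u} K}, A = B → Nonempty (A ≃ₗ[K] B) := by
    rintro A _ rfl
    exact ⟨LinearEquiv.refl K _⟩
  let ε {v x} (h : e.onV v = x) : M x ≃ₗ[K] Y.obj v := (toEquiv (hM h)).some
  have hmap : ∀ a, ∃ m : M (Q.t a) →ₗ[K] M (Q.h a), ∀ b (hb : e.onA b = a) (v : M (Q.t a)),
      ε ((e.h_onA b).symm.trans (congrArg Q.h hb)) (m v) =
        Y.map b (ε ((e.t_onA b).symm.trans (congrArg Q.t hb)) v) := by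
    intro a
    by_cases ha : ∃ b, e.onA b = a
    · obtain ⟨b, rfl⟩ := ha
      refine ⟨(ε (e.h_onA b).symm).symm.toLinearMap ∘ₗ Y.map b ∘ₗ
        (ε (e.t_onA b).symm).toLinearMap, fun b' hb' v => ?_⟩
      obtain rfl := e.onA_injective hb'
      exact LinearEquiv.apply_symm_apply _ _
    · exact ⟨0, fun b hb => absurd ⟨b, hb⟩ ha⟩
  choose m hm using hmap
  let X : QuiverRep K Q := { obj := fun x => M x, map := m }
  refine ⟨X, ⟨⟨fun v => ε rfl, fun b v => ?_⟩⟩⟩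
  have key : ∀ {x y} (ht : Q.t (e.onA b) = x) (hh : Q.h (e.onA b) = y) (hx : e.onV (P.t b) = x)
      (hy : e.onV (P.h b) = y) (v : M x),
      ε hy (X.stepMap (.arrow (e.onA b) ht hh) v) = Y.map b (ε hx v) := by
    rintro _ _ rfl rfl hx hy v
    exact hm _ b rfl v
  exact key (e.t_onA b) (e.h_onA b) rfl rfl v

end QuiverRep

open QuiverRep FinQuiver

theorem FiniteMultiplicativeType.of_embedding {K : Type u} [Field K] {P Q : FinQuiver.{w}}
    (e : Embedding P Q) (h : FiniteMultiplicativeType K Q) : FiniteMultiplicativeType K P := by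
  refine Module.Finite.reduction_of_surjective (pullRing e.toMorphism) (fun r => ?_) h
  have key : ∀ Y : IsoClass K P, ∃ X, pullRing e.toMorphism (cls X) = cls Y := by
    intro Y
    induction Y using IsoClass.ind with | _ Y
    obtain ⟨X, hX⟩ := exists_pull_iso_of_embedding e Y
    exact ⟨.mk X, by rw [pullRing_cls, pullClass_mk, IsoClass.mk_eq_mk.mpr hX]⟩
  obtain ⟨Y, Y', rfl⟩ := exists_eq_cls_sub r
  obtain ⟨X, hX⟩ := key Y
  obtain ⟨X', hX'⟩ := key Y'
  exact ⟨cls X - cls X', by rw [map_sub, hX, hX']⟩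

/-- If pullbacks jointly detect isomorphism, the ring homomorphisms are jointly injective: an
element in all kernels is a difference of two classes, and `cls_injective` turns the vanishing into
isomorphisms of pullbacks. -/
theorem FiniteMultiplicativeType.of_pull {K : Type u} [Field K] {ι : Type*} [Finite ι]
    {P : ι → FinQuiver.{w}} {Q : FinQuiver.{w}} (f : ∀ i, Morphism (P i) Q)
    (hf : ∀ X Y : QuiverRep K Q, (∀ i, Nonempty (Iso (X.pull (f i)) (Y.pull (f i)))) →
      Nonempty (Iso X Y)) (h : ∀ i, FiniteMultiplicativeType K (P i)) :
    FiniteMultiplicativeType K Q := by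
  refine Module.Finite.reduction_of_injective (fun i => pullRing (f i)) (fun r hr => ?_) h
  obtain ⟨X, Y, rfl⟩ := exists_eq_cls_sub r
  induction X using IsoClass.ind with | _ X
  induction Y using IsoClass.ind with | _ Y
  rw [IsoClass.mk_eq_mk.mpr (hf X Y fun i => ?_), sub_self]
  have := hr i
  rw [map_sub, sub_eq_zero, pullRing_cls, pullRing_cls] at this
  exact IsoClass.mk_eq_mk.mp (cls_injective this)

/-- Pulled-back representations have identity maps over the contracted arrows, so an isomorphism
between them agrees at the two ends of each such arrow and descends to the contraction. -/
theorem FiniteMultiplicativeType.contract {K : Type u} [Field K] {Q : FinQuiver.{w}}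
    (h : FiniteMultiplicativeType K Q) (C : Set Q.A) : FiniteMultiplicativeType K (Q.contract C) := by
  refine of_pull (fun _ : Unit => Q.toContract C) (fun X Y hXY => ?_) fun _ => h
  obtain ⟨e, he⟩ := hXY ()
  have he' : ∀ a v, e (Q.h a) (X.stepMap ((Q.toContract C).onA a) v) =
    Y.stepMap ((Q.toContract C).onA a) (e (Q.t a) v) := he
  -- Commuting with an identity step is the transport equation that `Quot.rec` asks for.
  have hid : ∀ {x y : (Q.contract C).V} (hxy : x = y) (f : X.obj x ≃ₗ[K] Y.obj x)
      (g : X.obj y ≃ₗ[K] Y.obj y), (∀ v, g (X.stepMap (.id hxy) v) = Y.stepMap (.id hxy) (f v)) →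
      hxy ▸ f = g := by
    rintro x _ rfl f g hfg
    exact LinearEquiv.ext fun v => (hfg v).symm
  refine ⟨⟨fun q => Quot.rec (motive := fun q : (Q.contract C).V => X.obj q ≃ₗ[K] Y.obj q) (fun x => e x) ?_ q, ?_⟩⟩
  · rintro _ _ ⟨a, ha, rfl, rfl⟩
    refine hid _ _ _ fun v => ?_
    have := he' a v
    simp only [toContract, dif_pos ha] at this
    exact this
  · rintro ⟨a, ha⟩ v
    have := he' a v
    simp only [toContract, dif_neg ha] at this
    exact this

theorem FiniteMultiplicativeType.of_isMinor {K : Type u} [Field K] {P Q : FinQuiver.{w}}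
    (hPQ : P.IsMinor Q) (h : FiniteMultiplicativeType K Q) : FiniteMultiplicativeType K P := by
  obtain ⟨C, ⟨e⟩⟩ := hPQ
  exact (h.contract C).of_embedding e

theorem FiniteMultiplicativeType.of_component {K : Type u} [Field K] {Q : FinQuiver.{w}}
    (h : ∀ κ, FiniteMultiplicativeType K (Q.component κ)) : FiniteMultiplicativeType K Q := by
  have := Q.finite_V
  have : Finite (Quot (Q.adjBy Set.univ)) := Finite.of_surjective (Quot.mk _) Quot.mk_surjective
  refine of_pull (fun κ => (Q.componentEmbedding κ).toMorphism) (fun X Y hXY => ?_) h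
  let e κ := (hXY κ).some
  let E (κ) (x : Q.V) (hx : Quot.mk (Q.adjBy Set.univ) x = κ) : X.obj x ≃ₗ[K] Y.obj x := (e κ).equiv ⟨x, hx⟩
  have hE : ∀ {κ κ'} (_ : κ = κ') x hx hx', E κ x hx = E κ' x hx' := by
    rintro κ _ rfl x hx hx'
    rfl
  refine ⟨⟨fun x => E _ x rfl, fun a v => ?_⟩⟩
  have hκ : Quot.mk (Q.adjBy Set.univ) (Q.h a) = Quot.mk _ (Q.t a) :=
    (Quot.sound ⟨a, Set.mem_univ _, rfl, rfl⟩).symm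
  rw [hE hκ (Q.h a) rfl hκ]
  exact (e _).comm ⟨a, rfl⟩ v

/-! ### The loop -/

/-- The vertex of the loop quiver. -/
def FinQuiver.loopVertex : loop.{w}.V := PUnit.unit

namespace QuiverRep

variable {K : Type u} [Field K]

/-- The endomorphism given by a representation of the loop. -/
def loopEnd (X : QuiverRep K loop.{w}) : Module.End K (X.obj loopVertex) := X.map PUnit.unit

/-- The traces of the powers of the endomorphism given by a representation of the loop. -/
noncomputable def loopTrace (X : QuiverRep K loop.{w}) (k : ℕ) : K :=
  LinearMap.trace K (X.obj loopVertex) (X.loopEnd ^ k)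

theorem loopTrace_iso {X Y : QuiverRep K loop.{w}} (e : Iso X Y) : X.loopTrace = Y.loopTrace := by
  funext k
  have h : ∀ v, e.equiv loopVertex ((X.loopEnd ^ k) v) =
      (Y.loopEnd ^ k) (e.equiv loopVertex v) := by
    induction k with
    | zero => exact fun _ => rfl
    | succ k ih =>
      intro v
      rw [pow_succ', pow_succ', Module.End.mul_apply, Module.End.mul_apply, ← ih]
      exact e.comm PUnit.unit _
  have h' : Y.loopEnd ^ k = (e.equiv loopVertex).conj (X.loopEnd ^ k) := by
    ext v
    rw [LinearEquiv.conj_apply_apply, h, LinearEquiv.apply_symm_apply]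
  rw [loopTrace, loopTrace, h', LinearMap.trace_conj']

theorem loopTrace_dirSum (X Y : QuiverRep K loop.{w}) :
    (X.dirSum Y).loopTrace = X.loopTrace + Y.loopTrace := by
  funext k
  have h : ∀ {V W : Type u} [AddCommGroup V] [Module K V] [FiniteDimensional K V] [AddCommGroup W]
      [Module K W] [FiniteDimensional K W] (f : Module.End K V) (g : Module.End K W),
      LinearMap.trace K (V × W) ((f.prodMap g : Module.End K (V × W)) ^ k) =
        LinearMap.trace K V (f ^ k) + LinearMap.trace K W (g ^ k) := by
    intro V W _ _ _ _ _ _ f g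
    rw [← LinearMap.trace_prodMap']
    congr 1
    induction k with
    | zero => rfl
    | succ k ih => rw [pow_succ, pow_succ, pow_succ, ih, LinearMap.prodMap_mul]
  exact h X.loopEnd Y.loopEnd

theorem loopTrace_tensor (X Y : QuiverRep K loop.{w}) :
    (X.tensor Y).loopTrace = X.loopTrace * Y.loopTrace := by
  funext k
  have h : ∀ {V W : Type u} [AddCommGroup V] [Module K V] [FiniteDimensional K V] [AddCommGroup W]
      [Module K W] [FiniteDimensional K W] (f : Module.End K V) (g : Module.End K W),
      LinearMap.trace K (TensorProduct K V W)
        ((TensorProduct.map f g : Module.End K (TensorProduct K V W)) ^ k) =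
        LinearMap.trace K V (f ^ k) * LinearMap.trace K W (g ^ k) := by
    intro V W _ _ _ _ _ _ f g
    rw [← LinearMap.trace_tensorProduct', TensorProduct.map_pow]
  exact h X.loopEnd Y.loopEnd

theorem loopTrace_unit : (unit K loop.{w}).loopTrace = 1 := by
  funext k
  have h : LinearMap.trace K K ((LinearMap.id : Module.End K K) ^ k) = 1 := by
    have : (LinearMap.id : Module.End K K) = 1 := rfl
    rw [this, one_pow, LinearMap.trace_one]
    simp
  exact h

/-- The ring homomorphism given by the traces of powers. -/
noncomputable def traceRing (K : Type u) [Field K] : RepRing K loop.{w} →+* (ℕ → K) :=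
  liftRing
    { toFun := Quotient.lift loopTrace fun _ _ ⟨e⟩ => loopTrace_iso e
      map_one' := loopTrace_unit
      map_mul' := by
        rintro ⟨X⟩ ⟨Y⟩
        exact loopTrace_tensor X Y } (by
    rintro ⟨X⟩ ⟨Y⟩
    exact loopTrace_dirSum X Y)

theorem traceRing_cls (X : QuiverRep K loop.{w}) : traceRing K (cls (.mk X)) = X.loopTrace :=
  liftRing_cls _ _ _

/-- The representation of the loop given by a cyclic permutation of length `n`. -/
def cycleRep (K : Type u) [Field K] (n : ℕ) [NeZero n] : QuiverRep K loop.{w} where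
  obj _ := ZMod n → K
  map _ := LinearMap.funLeft K K (· + 1)

/-- The `k`-th power is the permutation matrix of translation by `k`, and its trace counts fixed
points: all `n` of them or none. -/
theorem loopTrace_cycleRep (n : ℕ) [NeZero n] (k : ℕ) :
    (cycleRep.{w} K n).loopTrace k = if n ∣ k then (n : K) else 0 := by
  have hpow : ((LinearMap.funLeft K K (· + 1 : ZMod n → ZMod n) : Module.End K (ZMod n → K)) ^ k) =
      LinearMap.funLeft K K (· + (k : ZMod n)) := by
    induction k with
    | zero => ext; simp
    | succ k ih =>
      ext
      rw [pow_succ', ih]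
      simp [LinearMap.funLeft_apply, add_left_comm, add_comm]
  have h : LinearMap.trace K (ZMod n → K)
      ((LinearMap.funLeft K K (· + 1 : ZMod n → ZMod n) : Module.End K (ZMod n → K)) ^ k) =
      if n ∣ k then (n : K) else 0 := by
    rw [hpow, LinearMap.trace_eq_matrix_trace K (Pi.basisFun K (ZMod n)), Matrix.trace]
    simp only [Matrix.diag_apply, LinearMap.toMatrix_apply, Pi.basisFun_apply, Pi.basisFun_repr,
      LinearMap.funLeft_apply, Pi.single_apply, add_eq_left, ZMod.natCast_eq_zero_iff]
    split_ifs <;> simp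
  exact h

/-- Traces of powers map the ring to sequences in `K`, and finiteness would confine the image to a
finite-dimensional space. But a cycle of prime length `p` has trace `p` at `p` and `0` at every
other prime, so infinitely many cycles are linearly independent. -/
theorem not_finiteMultiplicativeType_loop : ¬ FiniteMultiplicativeType K loop.{w} := by
  intro h
  obtain ⟨s, hs⟩ := h
  -- The ring of sequences is reduced, so the trace homomorphism factors through the reduction.
  let ψ : RepRing K loop.{w} ⧸ nilradical (RepRing K loop.{w}) →+* (ℕ → K) :=
    Ideal.Quotient.lift _ (traceRing K) fun r hr =>
      (IsNilpotent.map (mem_nilradical.mp hr) (traceRing K)).eq_zero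
  let V : Submodule K (ℕ → K) := Submodule.span K (ψ '' s)
  have : Module.Finite K V := Module.Finite.span_of_finite K (s.finite_toSet.image ψ)
  have hV : ∀ r, ψ r ∈ V := by
    intro r
    have hr : r ∈ Submodule.span ℤ (s : Set _) := hs ▸ Submodule.mem_top
    induction hr using Submodule.span_induction with
    | mem r hr => exact Submodule.subset_span ⟨r, hr, rfl⟩
    | zero => rw [map_zero]; exact zero_mem _
    | add r r' _ _ h h' => rw [map_add]; exact add_mem h h'
    | smul n r _ h => rw [map_zsmul]; exact zsmul_mem h n
  -- Only the characteristic of `K`, if positive, is excluded, since there the diagonal entry `p`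
  -- would vanish.
  let S : Set ℕ := {p | p.Prime ∧ (p : K) ≠ 0}
  have hS : S.Infinite := by
    have hsub : {p : ℕ | p.Prime ∧ (p : K) = 0}.Subsingleton := by
      rintro p ⟨hp, hp0⟩ q ⟨hq, hq0⟩
      have h1 := (CharP.cast_eq_zero_iff K (ringChar K) p).mp hp0
      have h2 := (CharP.cast_eq_zero_iff K (ringChar K) q).mp hq0
      have hne : ringChar K ≠ 1 := CharP.ringChar_ne_one
      rw [← (hp.eq_one_or_self_of_dvd _ h1).resolve_left hne,
        ← (hq.eq_one_or_self_of_dvd _ h2).resolve_left hne]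
    refine (Nat.infinite_setOfPred_prime.sdiff hsub.finite).mono ?_
    rintro p ⟨hp, hp'⟩
    exact ⟨hp, fun h0 => hp' ⟨hp, h0⟩⟩
  have hne : ∀ p : S, NeZero p.1 := fun p => ⟨p.2.1.ne_zero⟩
  let v : S → V := fun p => ⟨ψ (Ideal.Quotient.mk _ (cls (.mk (cycleRep.{w} K p.1)))), hV _⟩
  have hv : ∀ p q : S, (v p).1 q = if p = q then (p.1 : K) else 0 := by
    intro p q
    refine (congrFun (traceRing_cls (cycleRep.{w} K p.1)) q.1).trans ?_
    rw [loopTrace_cycleRep]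
    simp only [Nat.prime_dvd_prime_iff_eq p.2.1 q.2.1, Subtype.ext_iff]
  have hlin : LinearIndependent K v := by
    rw [linearIndependent_iff']
    intro t g hg q hq
    have h0 := congrFun (congrArg Subtype.val hg) q.1
    simp only [AddSubmonoidClass.coe_finsetSum, Submodule.coe_smul, Finset.sum_apply,
      Pi.smul_apply, hv, smul_eq_mul, mul_ite, mul_zero, Finset.sum_ite_eq', hq, if_true] at h0
    exact (mul_eq_zero.mp h0).resolve_right q.2.2
  have := hlin.finite
  exact hS (Set.toFinite S)

end QuiverRep

theorem mainTheorem12 (K : Type u) [Field K] :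
    -- the class of quivers of finite multiplicative type over `K` is minor closed
    (∀ P Q : FinQuiver.{w}, P.IsMinor Q →
      FiniteMultiplicativeType K Q → FiniteMultiplicativeType K P) ∧
    -- the minor relation is a well-quasi-order on the set of tree quivers
    (IsPreorder FinQuiver.{w} FinQuiver.IsMinor ∧
      {Q : FinQuiver.{w} | Q.IsTree}.PartiallyWellOrderedOn FinQuiver.IsMinor) ∧
    -- finite multiplicative type over `K` is characterized by finitely many forbidden minors
    ∃ F : Set FinQuiver.{w}, F.Finite ∧
      ∀ Q : FinQuiver.{w}, FiniteMultiplicativeType K Q ↔ ∀ P ∈ F, ¬ P.IsMinor Q := by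
  refine ⟨fun P Q h hQ => hQ.of_isMinor h, ⟨isPreorder_isMinor, partiallyWellOrderedOn_isTree⟩, ?_⟩
  -- If no finite set sufficed, one could keep choosing trees not of finite multiplicative type that
  -- have no earlier choice as a minor, which contradicts the well-quasi-order.
  obtain ⟨B, hB, hBmin⟩ : ∃ B : Finset FinQuiver.{w}, (∀ P ∈ B, ¬ FiniteMultiplicativeType K P) ∧
      ∀ Q : FinQuiver.{w}, Q.IsTree → ¬ FiniteMultiplicativeType K Q → ∃ P ∈ B, P.IsMinor Q := by
    by_contra! hcon
    obtain ⟨f, hf, hbad⟩ := exists_seq_of_forall_finset_exists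
      (fun Q : FinQuiver.{w} => Q.IsTree ∧ ¬ FiniteMultiplicativeType K Q)
      (fun P Q => ¬ P.IsMinor Q) fun s hs => by
        obtain ⟨Q, h₁, h₂, h₃⟩ := hcon s fun P hP => (hs P hP).2
        exact ⟨Q, ⟨h₁, h₂⟩, h₃⟩
    obtain ⟨m, n, hmn, h⟩ := partiallyWellOrderedOn_isTree fun n => ⟨f n, (hf n).1⟩
    exact hbad m n hmn h
  refine ⟨insert loop B, B.finite_toSet.insert _, fun Q => ⟨?_, fun h => ?_⟩⟩
  · rintro hQ P (rfl | hP) hPQ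
    · exact not_finiteMultiplicativeType_loop (hQ.of_isMinor hPQ)
    · exact hB P hP (hQ.of_isMinor hPQ)
  -- Excluding the loop makes every component a tree, so an infinite component would have a minor in
  -- `B`, and then so would `Q`.
  · refine .of_component fun κ => ?_
    by_contra hκ
    obtain ⟨P, hP, hPκ⟩ := hBmin _ (isTree_component (h _ (Set.mem_insert _ _)) κ) hκ
    exact h P (Set.mem_insert_of_mem _ hP) (hPκ.trans (Q.componentEmbedding κ).isMinor)
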